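/- Let $n\ge 2$, let $(\widetilde M,\widetilde g)$ be an $m$-dimensional real space form $\widetilde M(c)$, i.e. a smooth Riemannian manifold of constant sectional curvature $c$, and let $(M,g)$ be an $n$-dimensional Riemannian submanifold of $\widetilde M(c)$ (smoothly immersed, with the induced metric), with second fundamental form $\sigma$. For $p\in M$ and an orthonormal basis $e_1,\dots,e_n$ of $T_pM$ put $$\tau_{\rm Nor}(p)=\frac{2}{n(n-1)}\sum_{1\le i<j\le n}K(e_i\wedge e_j),\qquad \mathcal C_p=\frac1n\sum_{i,j=1}^n\|\sigma(e_i,e_j)\|^2,$$ where $K$ is the sectional curvature of $M$. For a hyperplane $\Pi$ of $T_pM$ with orthonormal basis $e_1,\dots,e_{n-1}$ put $\mathcal C(\Pi)=\frac1{n-1}\sum_{i,j=1}^{n-1}\|\sigma(e_i,e_j)\|^2$, and let $$[\widehat\delta_{\mathcal C}(n-1)]_p=2\,\mathcal C_p-\frac{2n-1}{2n}\,\sup\{\mathcal C(\Pi):\Pi\text{ a hyperplane of }T_pM\}.$$ Then, for every $p\in M$, $$\tau_{\rm Nor}(p)\le[\widehat\delta_{\mathcal C}(n-1)]_p+c.$$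 Moreover, equality holds for all $p\in M$ if and only if $M$ is an invariantly quasi-umbilical submanifold with trivial normal connection (its normal curvature tensor $R^\perp$ vanishes) such that, at each $p\in M$, with respect to a suitable orthonormal basis $e_1,\dots,e_n$ of $T_pM$ and a suitable orthonormal basis $e_{n+1},\dots,e_m$ of $T_p^\perp M$, the shape operators $A_\alpha=A_{e_\alpha}$ are $$A_{n+1}=\operatorname{diag}\bigl(a,\dots,a,\tfrac12a\bigr),\qquad A_{n+2}=\cdots=A_m=0,$$ for some real number $a$ depending on $p$ (no condition if $m=n$). Here $M$ is invariantly quasi-umbilical if at each $p$ there are an orthonormal basis $N_{n+1},\dots,N_m$ of $T_p^\perp M$ and a unit vector $\xi\in T_pM$, the same for all $\alpha$, such that for every $\alpha$ the vector $\xi$ is an eigenvector of $A_{N_\alpha}$ and all vectors of $T_pM$ orthogonal to $\xi$ are eigenvectors of $A_{N_\alpha}$ for one common eigenvalue (so each $A_{N_\alpha}$ has an eigenvalue of multiplicity at least $n-1$). -/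

import Mathlib

open scoped Manifold ContDiff Bundle Topology RealInnerProductSpace

noncomputable section

/-! ### Local Riemannian geometry in a coordinate domain

A Riemannian metric on an open part of a normed space `E` is written as a field of bilinear forms
`G : E → E →L[ℝ] E →L[ℝ] ℝ`. -/

namespace LocalGeometry

section Intrinsic

variable {E : Type*} [NormedAddCommGroup E] [NormedSpace ℝ E]

/-- The Christoffel symbols `Γ(u, v)` of `G` at `y`: the vector determined by
`G(Γ(u, v), w) = ½ (∂_u G(v, w) + ∂_v G(u, w) - ∂_w G(u, v))` for all `w`. The Levi-Civita
connection of `G` is `∇_u V = ∂_u V + Γ(u, V)`. -/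
def christoffel (G : E → E →L[ℝ] E →L[ℝ] ℝ) (y u v : E) : E :=
  (G y).inverse ((1 / 2 : ℝ) •
    (fderiv ℝ G y u v + fderiv ℝ G y v u - fderiv ℝ (fun z ↦ G z u v) y))

/-- The curvature operator `R(u, v) w = ∇_u ∇_v w - ∇_v ∇_u w` of `G` at `y`, for constant
coordinate fields `u`, `v`, `w` (so that `[u, v] = 0`). -/
def curvature (G : E → E →L[ℝ] E →L[ℝ] ℝ) (y u v w : E) : E :=
  fderiv ℝ (fun z ↦ christoffel G z v w) y u - fderiv ℝ (fun z ↦ christoffel G z u w) y v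
    + christoffel G y u (christoffel G y v w) - christoffel G y v (christoffel G y u w)

end Intrinsic

section Extrinsic

variable {E E' : Type*} [NormedAddCommGroup E] [NormedSpace ℝ E]
  [NormedAddCommGroup E'] [NormedSpace ℝ E']

/-- The covariant derivative `∇̃_u V = ∂_u V + Γ̃(∂_u F, V)` of a vector field `V` along a map `F`
into a domain with metric `G'`. -/
def covAlong (G' : E' → E' →L[ℝ] E' →L[ℝ] ℝ) (F : E → E') (V : E → E') (y u : E) : E' :=
  fderiv ℝ V y u + christoffel G' (F y) (fderiv ℝ F y u) (V y)

/-- The metric induced by `F` from `G'`. -/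
def induced (G' : E' → E' →L[ℝ] E' →L[ℝ] ℝ) (F : E → E') (y : E) : E →L[ℝ] E →L[ℝ] ℝ :=
  (G' (F y)).bilinearComp (fderiv ℝ F y) (fderiv ℝ F y)

/-- The `G'`-orthogonal projection of a vector `w` at `F y` onto the orthogonal complement of the
image of `dF` at `y`: one subtracts `dF(t)`, where `G'(dF t, dF u) = G'(w, dF u)` for all `u`. -/
def normalPart (G' : E' → E' →L[ℝ] E' →L[ℝ] ℝ) (F : E → E') (y : E) (w : E') : E' :=
  w - fderiv ℝ F y ((induced G' F y).inverse ((G' (F y) w) ∘L fderiv ℝ F y))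

/-- The second fundamental form of the immersion `F` at `y`: the normal part of the ambient
covariant derivative `∇̃_u (dF v)`. -/
def secondFundamentalForm (G' : E' → E' →L[ℝ] E' →L[ℝ] ℝ) (F : E → E') (y u v : E) : E' :=
  normalPart G' F y (covAlong G' F (fun z ↦ fderiv ℝ F z v) y u)

/-- The normal connection `∇^⊥_u N`: the normal part of `∇̃_u N`. -/
def normalCov (G' : E' → E' →L[ℝ] E' →L[ℝ] ℝ) (F : E → E') (N : E → E') (y u : E) : E' :=
  normalPart G' F y (covAlong G' F N y u)

/-- The normal curvature `R^⊥(u, v) N = ∇^⊥_u ∇^⊥_v N - ∇^⊥_v ∇^⊥_u N` for constant coordinate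
fields `u`, `v` (so that `[u, v] = 0`) and a normal field `N`. -/
def normalCurvature (G' : E' → E' →L[ℝ] E' →L[ℝ] ℝ) (F : E → E') (N : E → E') (y u v : E) : E' :=
  normalCov G' F (fun z ↦ normalCov G' F N z v) y u
    - normalCov G' F (fun z ↦ normalCov G' F N z u) y v

end Extrinsic

end LocalGeometry

/-! ### Riemannian manifolds -/

section Manifold

variable {n : ℕ} {M : Type*} [TopologicalSpace M] [ChartedSpace (EuclideanSpace ℝ (Fin n)) M]

instance instFiniteDimensionalTangentSpace (p : M) : FiniteDimensional ℝ (TangentSpace (𝓡 n) p) :=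
  inferInstanceAs (FiniteDimensional ℝ (EuclideanSpace ℝ (Fin n)))

variable [Bundle.RiemannianBundle (fun x : M ↦ TangentSpace (𝓡 n) x)]

/-- The metric of `M` in the preferred chart at `p`, a field of bilinear forms on the coordinate
space: the pull-back of the metric by the inverse of the chart. -/
def chartMetric (p : M) (y : EuclideanSpace ℝ (Fin n)) :
    EuclideanSpace ℝ (Fin n) →L[ℝ] EuclideanSpace ℝ (Fin n) →L[ℝ] ℝ :=
  (innerSL ℝ (E := TangentSpace (𝓡 n) ((extChartAt (𝓡 n) p).symm y))).bilinearComp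
    (mfderiv (𝓡 n) (𝓡 n) (extChartAt (𝓡 n) p).symm y)
    (mfderiv (𝓡 n) (𝓡 n) (extChartAt (𝓡 n) p).symm y)

theorem chartMetric_apply (p : M) (y u v : EuclideanSpace ℝ (Fin n)) :
    chartMetric p y u v =
      (inner ℝ (mfderiv (𝓡 n) (𝓡 n) (extChartAt (𝓡 n) p).symm y u)
        (mfderiv (𝓡 n) (𝓡 n) (extChartAt (𝓡 n) p).symm y v) : ℝ) := rfl

/-- The coordinates in the preferred chart at `p` of a tangent vector at `p`. -/
def chartVector (p : M) (X : TangentSpace (𝓡 n) p) : EuclideanSpace ℝ (Fin n) :=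
  mfderiv (𝓡 n) (𝓡 n) (extChartAt (𝓡 n) p) p X

/-- The Riemann curvature tensor `R(X, Y, Z, W) = g(R(X, Y) Z, W)` of `M` at `p`, computed in the
preferred chart at `p`. -/
def riemannTensor (p : M) (X Y Z W : TangentSpace (𝓡 n) p) : ℝ :=
  chartMetric p (extChartAt (𝓡 n) p p)
    (LocalGeometry.curvature (chartMetric p) (extChartAt (𝓡 n) p p)
      (chartVector p X) (chartVector p Y) (chartVector p Z)) (chartVector p W)

/-- The sectional curvature `K(X ∧ Y) = R(X, Y, Y, X)` of the plane spanned by two orthonormal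
tangent vectors `X`, `Y`. -/
def sectionalCurvature (p : M) (X Y : TangentSpace (𝓡 n) p) : ℝ := riemannTensor p X Y Y X

variable (n M) in
/-- `M` has constant sectional curvature `c`, i.e. it is a real space form `M(c)`. -/
def HasConstantSectionalCurvature (c : ℝ) : Prop :=
  ∀ (q : M) (X Y : TangentSpace (𝓡 n) q), ‖X‖ = 1 → ‖Y‖ = 1 → ⟪X, Y⟫ = 0 →
    sectionalCurvature q X Y = c

variable (n) in
/-- The scalar curvature `τ(p) = ∑_{i < j} K(e_i ∧ e_j)`, for an orthonormal basis `e` of the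
tangent space (its value does not depend on the basis). -/
def scalarCurvature (p : M) : ℝ :=
  let e := stdOrthonormalBasis ℝ (TangentSpace (𝓡 n) p)
  ∑ i, ∑ j with i < j, sectionalCurvature p (e i) (e j)

variable (n) in
/-- The normalized scalar curvature `τ_Nor(p) = 2 τ(p) / (n (n - 1))`. -/
def normalizedScalarCurvature (p : M) : ℝ :=
  2 * scalarCurvature n p / ((n : ℝ) * ((n : ℝ) - 1))

end Manifold

/-! ### Riemannian submanifolds -/

section Submanifold

variable {n m : ℕ}
  {M : Type*} [TopologicalSpace M] [ChartedSpace (EuclideanSpace ℝ (Fin n)) M]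
  [Bundle.RiemannianBundle (fun x : M ↦ TangentSpace (𝓡 n) x)]
  {M' : Type*} [TopologicalSpace M'] [ChartedSpace (EuclideanSpace ℝ (Fin m)) M']
  [Bundle.RiemannianBundle (fun x : M' ↦ TangentSpace (𝓡 m) x)]

variable (n m) in
/-- `M` is a Riemannian submanifold of `M'` through `f`: `f` is smooth and the metric of `M` is the
one induced by `f` (in particular `f` is an immersion). -/
structure IsRiemannianSubmanifold (f : M → M') : Prop where
  smooth : ContMDiff (𝓡 n) (𝓡 m) ∞ f
  isometric : ∀ (p : M) (X Y : TangentSpace (𝓡 n) p),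
    ⟪mfderiv (𝓡 n) (𝓡 m) f p X, mfderiv (𝓡 n) (𝓡 m) f p Y⟫ = ⟪X, Y⟫

/-- The map `f` in the preferred charts at `p` and at `f p`. -/
def chartMap (f : M → M') (p : M) (y : EuclideanSpace ℝ (Fin n)) : EuclideanSpace ℝ (Fin m) :=
  extChartAt (𝓡 m) (f p) (f ((extChartAt (𝓡 n) p).symm y))

/-- `ν` is an orthonormal frame of the normal space `T_p^⊥ M`: `m - n` orthonormal vectors that are
orthogonal to the image of `df_p`. -/
def IsNormalFrame (f : M → M') (p : M) (ν : Fin (m - n) → TangentSpace (𝓡 m) (f p)) : Prop :=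
  Orthonormal ℝ ν ∧ ∀ (α : Fin (m - n)) (X : TangentSpace (𝓡 n) p),
    ⟪ν α, mfderiv (𝓡 n) (𝓡 m) f p X⟫ = 0

/-- The second fundamental form `σ_p(X, Y)` of the immersion `f`. -/
def secondFundamentalForm (f : M → M') (p : M) (X Y : TangentSpace (𝓡 n) p) :
    TangentSpace (𝓡 m) (f p) :=
  (mfderiv (𝓡 m) (𝓡 m) (extChartAt (𝓡 m) (f p)) (f p)).inverse
    (LocalGeometry.secondFundamentalForm (chartMetric (f p)) (chartMap f p) (extChartAt (𝓡 n) p p)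
      (chartVector p X) (chartVector p Y))

/-- The shape operator `A_N` at `p` in the direction of a normal vector `N`: the endomorphism with
`g(A_N X, Y) = g'(σ(X, Y), N)`, expanded in an orthonormal basis. -/
def shapeOperator (f : M → M') (p : M) (N : TangentSpace (𝓡 m) (f p))
    (X : TangentSpace (𝓡 n) p) : TangentSpace (𝓡 n) p :=
  let e := stdOrthonormalBasis ℝ (TangentSpace (𝓡 n) p)
  ∑ i, ⟪secondFundamentalForm f p X (e i), N⟫ • e i

/-- The matrix of the shape operator `A_N` in an orthonormal frame `e` of the tangent space. -/
def shapeMatrix (f : M → M') (p : M) (e : Fin n → TangentSpace (𝓡 n) p)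
    (N : TangentSpace (𝓡 m) (f p)) : Matrix (Fin n) (Fin n) ℝ :=
  Matrix.of fun i j ↦ inner ℝ (e i) (shapeOperator f p N (e j))

variable (m) in
/-- The Casorati curvature `C(Π) = (1/k) ∑_{i,j ≤ k} ‖σ(e_i, e_j)‖²` of a `k`-dimensional subspace
`Π` of `T_p M` with orthonormal basis `e` (its value does not depend on the basis). -/
def casoratiSubspace (f : M → M') (p : M)
    (P : Submodule ℝ (TangentSpace (𝓡 n) p)) : ℝ :=
  let e := stdOrthonormalBasis ℝ P
  (1 / (Module.finrank ℝ P : ℝ)) *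
    ∑ i, ∑ j, ‖secondFundamentalForm (m := m) f p (e i : TangentSpace (𝓡 n) p) (e j)‖ ^ 2

variable (n m) in
/-- The Casorati curvature `C_p = (1/n) ‖σ‖²`, which is `C(T_p M)`. -/
def casorati (f : M → M') (p : M) : ℝ := 
  casoratiSubspace m f p (⊤ : Submodule ℝ (TangentSpace (𝓡 n) p))

variable (n m) in
/-- The normalized `δ`-Casorati curvature
`δ̂_C(n - 1) = 2 C_p - (2n - 1)/(2n) sup {C(Π) : Π a hyperplane of T_p M}`. -/
def deltaHatCasorati (f : M → M') (p : M) : ℝ :=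
  2 * casorati n m f p - (2 * (n : ℝ) - 1) / (2 * (n : ℝ)) *
    sSup {x : ℝ | ∃ P : Submodule ℝ (TangentSpace (𝓡 n) p),
      Module.finrank ℝ P + 1 = n ∧ x = casoratiSubspace m f p P}

variable (n m) in
/-- `p` is an invariantly quasi-umbilical point: there are an orthonormal normal frame `N` and a
unit tangent vector `ξ`, the distinguished direction common to all `N_α`, which is an eigenvector
of every shape operator `A_{N_α}`, the `(n - 1)`-dimensional complement of `ξ` consisting of
eigenvectors of `A_{N_α}` for one eigenvalue. -/
def IsInvariantlyQuasiUmbilicalAt (f : M → M') (p : M) : Prop :=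
  ∃ (N : Fin (m - n) → TangentSpace (𝓡 m) (f p)) (ξ : TangentSpace (𝓡 n) p),
    IsNormalFrame f p N ∧ ‖ξ‖ = 1 ∧ ∀ α, ∃ lam mu : ℝ, shapeOperator f p (N α) ξ = mu • ξ ∧
      ∀ X : TangentSpace (𝓡 n) p, ⟪X, ξ⟫ = 0 → shapeOperator f p (N α) X = lam • X

variable (n m) in
/-- The normal connection of `f` is trivial (flat): its curvature `R^⊥(X, Y) N` vanishes at every
point, for all smooth local normal fields `N`. The field is written in the preferred charts. -/
def HasTrivialNormalConnection (f : M → M') : Prop :=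
  ∀ (p : M) (N : EuclideanSpace ℝ (Fin n) → EuclideanSpace ℝ (Fin m)),
    ContDiffAt ℝ ∞ N (extChartAt (𝓡 n) p p) →
    (∀ᶠ y in 𝓝 (extChartAt (𝓡 n) p p), ∀ u,
      chartMetric (f p) (chartMap f p y) (N y) (fderiv ℝ (chartMap f p) y u) = 0) →
    ∀ X Y : TangentSpace (𝓡 n) p,
      LocalGeometry.normalCurvature (chartMetric (f p)) (chartMap f p) N (extChartAt (𝓡 n) p p)
        (chartVector p X) (chartVector p Y) = 0

end Submanifold

end

section

set_option maxSynthPendingDepth 3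
set_option linter.unusedSectionVars false

namespace LocalGeometry

/-! Write n = k + 1. Tracing the Gauss equation in an ambient space of constant curvature c gives 2τ
= n(n - 1)c + ‖tr σ‖² - ‖σ‖². After multiplication by k(k + 1), the claim becomes ‖tr σ‖² + (2k +
1)/2 · ‖σ|P‖² ≤ (2k + 1)‖σ‖² for a hyperplane P maximizing ‖σ|P‖²; in fact it holds for every
hyperplane. In an orthonormal basis adapted to P, put x_i = σ(e_i, e_i) for the k vectors in P and g
= σ(e_n, e_n). The heart is the weighted Cauchy–Schwarz inequality ‖Σ x_i + g‖² ≤ (2k + 1)(½ Σ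
‖x_i‖² + ‖g‖²) of `norm_sum_add_sq_le`, an equality exactly when every x_i is 2g. Off-diagonal
entries weigh more on the right than on the left.

The supremum is attained (`exists_max_restrictNormSq`), so equality at p means that the
vector-valued form σ is diagonal in some orthonormal basis with entries 2g, …, 2g, g
(`IsHalfUmbilicalBasis`, `casorati_inequality`). The whole equality case is read off from such a
basis. Its last vector is the quasi-umbilical direction. A normal frame whose first vector points
along g yields the prescribed matrices. The shape operators are simultaneously diagonal, so the
Ricci equation, whose ambient term has no normal part in a space form, gives R^⊥ = 0. Conversely,
the matrices determine σ, because the frame spans the normal space.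

The geometric input (Gauss, Weingarten and Ricci equations, and the fact that constant sectional
curvature fixes the full curvature tensor) is proved in coordinates and carried to the manifolds
through the preferred charts. -/

theorem two_le_infty : (2 : WithTop ℕ∞) ≤ ∞ := WithTop.coe_le_coe.2 (le_top : (2 : ℕ∞) ≤ ⊤)

/-! ### Levi-Civita connection and curvature of a metric in coordinates -/

section Metric

variable {E : Type*} [NormedAddCommGroup E] [NormedSpace ℝ E]

/-- `G` is a smooth Riemannian metric on the open set `s`. -/
structure IsMetricOn (G : E → E →L[ℝ] E →L[ℝ] ℝ) (s : Set E) : Prop where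
  isOpen : IsOpen s
  contDiffOn : ContDiffOn ℝ ∞ G s
  symm : ∀ y ∈ s, ∀ u v, G y u v = G y v u
  pos : ∀ y ∈ s, ∀ u, u ≠ 0 → 0 < G y u u

/-- The derivatives of `G` that enter the Christoffel symbols, as a trilinear form. -/
noncomputable def christoffelForm (G : E → E →L[ℝ] E →L[ℝ] ℝ) (y : E) :
    E →L[ℝ] E →L[ℝ] E →L[ℝ] ℝ :=
  (1 / 2 : ℝ) • (fderiv ℝ G y + (fderiv ℝ G y).flip
    - ((ContinuousLinearMap.flipₗᵢ ℝ E E ℝ).toContinuousLinearEquiv :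
        (E →L[ℝ] E →L[ℝ] ℝ) →L[ℝ] (E →L[ℝ] E →L[ℝ] ℝ)) ∘L (fderiv ℝ G y).flip)

/-- The Christoffel symbols as a continuous bilinear map. -/
noncomputable def christoffelL (G : E → E →L[ℝ] E →L[ℝ] ℝ) (y : E) : E →L[ℝ] E →L[ℝ] E :=
  (ContinuousLinearMap.compL ℝ E (E →L[ℝ] ℝ) E (G y).inverse) ∘L christoffelForm G y

theorem christoffelForm_apply (G : E → E →L[ℝ] E →L[ℝ] ℝ) (y u v w : E) :
    christoffelForm G y u v w =
      1 / 2 * (fderiv ℝ G y u v w + fderiv ℝ G y v u w - fderiv ℝ G y w u v) := by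
  simp [christoffelForm]

theorem christoffelL_apply (G : E → E →L[ℝ] E →L[ℝ] ℝ) (y u v : E) :
    christoffelL G y u v = (G y).inverse (christoffelForm G y u v) := rfl

theorem fderiv_apply_apply {X F F' F'' : Type*} [NormedAddCommGroup X] [NormedSpace ℝ X]
    [NormedAddCommGroup F] [NormedSpace ℝ F] [NormedAddCommGroup F'] [NormedSpace ℝ F']
    [NormedAddCommGroup F''] [NormedSpace ℝ F'']
    {B : X → F →L[ℝ] F' →L[ℝ] F''} {a : X → F} {b : X → F'} {y : X}
    (hB : DifferentiableAt ℝ B y) (ha : DifferentiableAt ℝ a y) (hb : DifferentiableAt ℝ b y)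
    (u : X) :
    fderiv ℝ (fun z ↦ B z (a z) (b z)) y u =
      fderiv ℝ B y u (a y) (b y) + B y (fderiv ℝ a y u) (b y) + B y (a y) (fderiv ℝ b y u) := by
  rw [((hB.hasFDerivAt.clm_apply ha.hasFDerivAt).clm_apply hb.hasFDerivAt).fderiv]
  simp
  abel

theorem fderiv_const_apply_apply {X F F' F'' : Type*} [NormedAddCommGroup X] [NormedSpace ℝ X]
    [NormedAddCommGroup F] [NormedSpace ℝ F] [NormedAddCommGroup F'] [NormedSpace ℝ F']
    [NormedAddCommGroup F''] [NormedSpace ℝ F'']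
    {B : X → F →L[ℝ] F' →L[ℝ] F''} {y : X} (hB : DifferentiableAt ℝ B y) (u : X) (v : F) (w : F') :
    fderiv ℝ (fun z ↦ B z v w) y u = fderiv ℝ B y u v w := by
  rw [fderiv_apply_apply hB (differentiableAt_const v) (differentiableAt_const w)]
  simp

/-- Once G is differentiable the two forms of the Christoffel symbols agree; bilinearity and
smoothness are visible only in the operator form. -/
theorem christoffel_eq {G : E → E →L[ℝ] E →L[ℝ] ℝ} {y : E} (hG : DifferentiableAt ℝ G y)
    (u v : E) : christoffel G y u v = christoffelL G y u v := by
  rw [christoffelL_apply, christoffel]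
  congr 1
  ext w
  rw [christoffelForm_apply]
  simp [fderiv_const_apply_apply hG]

namespace IsMetricOn

variable {G : E → E →L[ℝ] E →L[ℝ] ℝ} {s : Set E} (h : IsMetricOn G s) {y : E} (hy : y ∈ s)
include h hy

theorem contDiffAt : ContDiffAt ℝ ∞ G y := h.contDiffOn.contDiffAt (h.isOpen.mem_nhds hy)

theorem differentiableAt : DifferentiableAt ℝ G y := (h.contDiffAt hy).differentiableAt (by simp)

theorem eventually_mem : ∀ᶠ z in 𝓝 y, z ∈ s := h.isOpen.mem_nhds hy

/-- Positive definiteness gives injectivity, and the dimensions of E and its dual agree. Without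
this `inverse` would take its default value 0 and the Christoffel symbols would be meaningless. -/
theorem isInvertible [FiniteDimensional ℝ E] : (G y).IsInvertible := by
  have hinj : Function.Injective (G y) := by
    rw [injective_iff_map_eq_zero]
    intro u hu
    by_contra hne
    have := h.pos y hy u hne
    rw [hu] at this
    simp at this
  have hfr : Module.finrank ℝ E = Module.finrank ℝ (E →L[ℝ] ℝ) := by
    rw [← Subspace.dual_finrank_eq]
    exact (LinearMap.toContinuousLinearMap (𝕜 := ℝ) (E := E) (F' := ℝ)).finrank_eq
  refine ⟨(LinearEquiv.ofInjectiveOfFinrankEq (G y : E →ₗ[ℝ] E →L[ℝ] ℝ)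
    hinj hfr).toContinuousLinearEquiv, ?_⟩
  rfl

theorem apply_inverse [FiniteDimensional ℝ E] (l : E →L[ℝ] ℝ) (w : E) :
    G y ((G y).inverse l) w = l w := by
  rw [(h.isInvertible hy).self_apply_inverse]

theorem ext_right {a b : E} (hab : ∀ w, G y a w = G y b w) : a = b := by
  by_contra hne
  have := h.pos y hy (a - b) (sub_ne_zero.2 hne)
  simp [hab] at this

theorem contDiffAt_inverse [FiniteDimensional ℝ E] :
    ContDiffAt ℝ ∞ (fun z ↦ (G z).inverse) y :=
  ContDiffAt.comp y (h.isInvertible hy).contDiffAt_map_inverse (h.contDiffAt hy)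

theorem contDiffAt_christoffelL [FiniteDimensional ℝ E] : ContDiffAt ℝ ∞ (christoffelL G) y := by
  have hD : ContDiffAt ℝ ∞ (fderiv ℝ G) y := (h.contDiffAt hy).fderiv_right (by simp)
  have hF : ContDiffAt ℝ ∞ (fun z ↦ (fderiv ℝ G z).flip) y :=
    (ContinuousLinearMap.flipₗᵢ ℝ E E
      (E →L[ℝ] ℝ)).toContinuousLinearEquiv.contDiff.contDiffAt.comp y hD
  have hform : ContDiffAt ℝ ∞ (christoffelForm G) y :=
    ((hD.add hF).sub (contDiffAt_const.clm_comp hF)).const_smul (1 / 2 : ℝ)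
  exact ((ContinuousLinearMap.compL ℝ E (E →L[ℝ] ℝ) E).contDiff.contDiffAt.comp y
    (h.contDiffAt_inverse hy)).clm_comp hform

theorem differentiableAt_christoffelL [FiniteDimensional ℝ E] :
    DifferentiableAt ℝ (christoffelL G) y :=
  (h.contDiffAt_christoffelL hy).differentiableAt (by simp)

theorem fderiv_symm (u v w : E) : fderiv ℝ G y u v w = fderiv ℝ G y u w v := by
  rw [← fderiv_const_apply_apply (h.differentiableAt hy),
    ← fderiv_const_apply_apply (h.differentiableAt hy)]
  have : (fun z ↦ G z v w) =ᶠ[𝓝 y] fun z ↦ G z w v := by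
    filter_upwards [h.eventually_mem hy] with z hz using h.symm z hz v w
  rw [this.fderiv_eq]

theorem christoffelL_symm (u v : E) : christoffelL G y u v = christoffelL G y v u := by
  rw [christoffelL_apply, christoffelL_apply]
  congr 1
  ext w
  rw [christoffelForm_apply, christoffelForm_apply, h.fderiv_symm hy w u v]
  ring

theorem christoffelL_spec [FiniteDimensional ℝ E] (u v w : E) : G y (christoffelL G y u v) w =
    1 / 2 * (fderiv ℝ G y u v w + fderiv ℝ G y v u w - fderiv ℝ G y w u v) := by
  rw [christoffelL_apply, h.apply_inverse hy, christoffelForm_apply]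

/-- Metric compatibility: in the sum of the two Koszul expressions the derivatives in the directions
v and w cancel. -/
theorem fderiv_eq [FiniteDimensional ℝ E] (u v w : E) : fderiv ℝ G y u v w =
    G y (christoffelL G y u v) w + G y v (christoffelL G y u w) := by
  rw [h.symm y hy v, h.christoffelL_spec hy, h.christoffelL_spec hy, h.fderiv_symm hy u w v,
    h.fderiv_symm hy w u v, h.fderiv_symm hy v u w]
  ring

theorem curvature_eq (u v w : E) [FiniteDimensional ℝ E] : curvature G y u v w =
    fderiv ℝ (christoffelL G) y u v w - fderiv ℝ (christoffelL G) y v u w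
      + christoffelL G y u (christoffelL G y v w) - christoffelL G y v (christoffelL G y u w) := by
  have hev (a b : E) : (fun z ↦ christoffel G z a b) =ᶠ[𝓝 y] fun z ↦ christoffelL G z a b := by
    filter_upwards [h.eventually_mem hy] with z hz using christoffel_eq (h.differentiableAt hz) a b
  rw [curvature, (hev v w).fderiv_eq, (hev u w).fderiv_eq,
    fderiv_const_apply_apply (h.differentiableAt_christoffelL hy),
    fderiv_const_apply_apply (h.differentiableAt_christoffelL hy)]
  simp only [christoffel_eq (h.differentiableAt hy)]

end IsMetricOn

end Metric

/-! ### Covariant differentiation along a map -/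

section Along

variable {E E' : Type*} [NormedAddCommGroup E] [NormedSpace ℝ E]
  [NormedAddCommGroup E'] [NormedSpace ℝ E'] [FiniteDimensional ℝ E']

variable {G' : E' → E' →L[ℝ] E' →L[ℝ] ℝ} {s' : Set E'} (h' : IsMetricOn G' s')
  {F : E → E'} {s : Set E} (hs : IsOpen s) (hF : ContDiffOn ℝ ∞ F s) (hmap : Set.MapsTo F s s')
  {y : E} (hy : y ∈ s)
include h' hmap hy

theorem covAlong_eq (V : E → E') (u : E) : covAlong G' F V y u =
    fderiv ℝ V y u + christoffelL G' (F y) (fderiv ℝ F y u) (V y) := by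
  rw [covAlong, christoffel_eq (h'.differentiableAt (hmap hy))]

include hs hF

omit h' hmap in
theorem contDiffAt_map : ContDiffAt ℝ ∞ F y := hF.contDiffAt (hs.mem_nhds hy)

omit h' hmap in
theorem contDiffAt_fderiv_map (u : E) : ContDiffAt ℝ ∞ (fun z ↦ fderiv ℝ F z u) y :=
  ((contDiffAt_map hs hF hy).fderiv_right (by simp)).clm_apply contDiffAt_const

omit h' hmap in
theorem fderiv_fderiv_map_symm (u v : E) :
    fderiv ℝ (fun z ↦ fderiv ℝ F z v) y u = fderiv ℝ (fun z ↦ fderiv ℝ F z u) y v := by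
  have hD : DifferentiableAt ℝ (fderiv ℝ F) y :=
    ((contDiffAt_map hs hF hy).fderiv_right (m := 1)
      (by rw [one_add_one_eq_two]; exact two_le_infty)).differentiableAt
      (by simp)
  have h1 (a b : E) : fderiv ℝ (fun z ↦ fderiv ℝ F z a) y b = fderiv ℝ (fderiv ℝ F) y b a := by
    rw [(hD.hasFDerivAt.clm_apply (hasFDerivAt_const a y)).fderiv]
    simp
  rw [h1, h1]
  exact ((contDiffAt_map hs hF hy).isSymmSndFDerivAt (by
    rw [minSmoothness_of_isRCLikeNormedField]; exact two_le_infty)).eq u v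

theorem covAlong_fderiv_symm (u v : E) :
    covAlong G' F (fun z ↦ fderiv ℝ F z v) y u = covAlong G' F (fun z ↦ fderiv ℝ F z u) y v := by
  rw [covAlong_eq h' hmap hy, covAlong_eq h' hmap hy, fderiv_fderiv_map_symm hs hF hy,
    h'.christoffelL_symm (hmap hy)]

theorem contDiffAt_covAlong {k : ℕ∞} {V : E → E'} (hV : ContDiffAt ℝ (k + 1) V y) (u : E) :
    ContDiffAt ℝ k (fun z ↦ covAlong G' F V z u) y := by
  have hev : (fun z ↦ covAlong G' F V z u) =ᶠ[𝓝 y]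
      fun z ↦ fderiv ℝ V z u + christoffelL G' (F z) (fderiv ℝ F z u) (V z) := by
    filter_upwards [hs.mem_nhds hy] with z hz using covAlong_eq h' hmap hz V u
  refine ContDiffAt.congr_of_eventuallyEq ?_ hev
  have hk : (k : WithTop ℕ∞) ≤ ∞ := by exact_mod_cast le_top
  refine ((hV.fderiv_right le_rfl).clm_apply contDiffAt_const).add ?_
  exact ((((h'.contDiffAt_christoffelL (hmap hy)).comp y
    (contDiffAt_map hs hF hy)).of_le hk).clm_apply
      ((contDiffAt_fderiv_map hs hF hy u).of_le hk)).clm_apply (hV.of_le le_self_add)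

/-- Metric compatibility along F: the product rule, with the derivative of G' rewritten by
`IsMetricOn.fderiv_eq`. -/
theorem fderiv_inner_along {V W : E → E'} (hV : DifferentiableAt ℝ V y)
    (hW : DifferentiableAt ℝ W y) (u : E) :
    fderiv ℝ (fun z ↦ G' (F z) (V z) (W z)) y u =
      G' (F y) (covAlong G' F V y u) (W y) + G' (F y) (V y) (covAlong G' F W y u) := by
  have hFd : DifferentiableAt ℝ F y := (contDiffAt_map hs hF hy).differentiableAt (by simp)
  have hG := h'.differentiableAt (hmap hy)
  rw [fderiv_apply_apply (B := fun z ↦ G' (F z)) (hG.comp y hFd) hV hW,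
    covAlong_eq h' hmap hy, covAlong_eq h' hmap hy]
  have : fderiv ℝ (fun z ↦ G' (F z)) y u = fderiv ℝ G' (F y) (fderiv ℝ F y u) := by
    rw [show (fun z ↦ G' (F z)) = G' ∘ F from rfl, fderiv_comp y hG hFd]
    rfl
  rw [this, h'.fderiv_eq (hmap hy)]
  simp only [map_add, _root_.add_apply]
  ring

/-- Curvature as a commutator. The second derivatives of V and of F are symmetric and cancel, as do
the products of Christoffel symbols with first derivatives of V; what remains is the coordinate
formula for the curvature. The Gauss and Ricci equations are the tangential and normal parts of this
identity. -/
theorem covAlong_covAlong_sub {V : E → E'} (hV : ContDiffAt ℝ 2 V y) (u v : E) :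
    covAlong G' F (fun z ↦ covAlong G' F V z v) y u
      - covAlong G' F (fun z ↦ covAlong G' F V z u) y v =
    curvature G' (F y) (fderiv ℝ F y u) (fderiv ℝ F y v) (V y) := by
  have hFd : DifferentiableAt ℝ F y := (contDiffAt_map hs hF hy).differentiableAt (by simp)
  have hΓ := h'.differentiableAt_christoffelL (hmap hy)
  have hV1 : DifferentiableAt ℝ V y := hV.differentiableAt (by simp)
  have hDV : DifferentiableAt ℝ (fderiv ℝ V) y :=
    (hV.fderiv_right (m := 1) (by norm_num)).differentiableAt (by simp)
  have hsec : fderiv ℝ (fun z ↦ fderiv ℝ V z v) y u = fderiv ℝ (fun z ↦ fderiv ℝ V z u) y v := by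
    have h1 (a b : E) : fderiv ℝ (fun z ↦ fderiv ℝ V z a) y b = fderiv ℝ (fderiv ℝ V) y b a := by
      rw [(hDV.hasFDerivAt.clm_apply (hasFDerivAt_const a y)).fderiv]
      simp
    rw [h1, h1]
    exact (hV.isSymmSndFDerivAt (by simp)).eq u v
  have key (a b : E) : fderiv ℝ (fun z ↦ covAlong G' F V z a) y b =
      fderiv ℝ (fun z ↦ fderiv ℝ V z a) y b +
        (fderiv ℝ (christoffelL G') (F y) (fderiv ℝ F y b) (fderiv ℝ F y a) (V y)
        + christoffelL G' (F y) (fderiv ℝ (fun z ↦ fderiv ℝ F z a) y b) (V y)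
        + christoffelL G' (F y) (fderiv ℝ F y a) (fderiv ℝ V y b)) := by
    have hev : (fun z ↦ covAlong G' F V z a) =ᶠ[𝓝 y]
        fun z ↦ fderiv ℝ V z a + christoffelL G' (F z) (fderiv ℝ F z a) (V z) := by
      filter_upwards [hs.mem_nhds hy] with z hz using covAlong_eq h' hmap hz V a
    have hBd : DifferentiableAt ℝ (fun z ↦ christoffelL G' (F z)) y := hΓ.comp y hFd
    have had : DifferentiableAt ℝ (fun z ↦ fderiv ℝ F z a) y :=
      (contDiffAt_fderiv_map hs hF hy a).differentiableAt (by simp)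
    rw [hev.fderiv_eq, fderiv_fun_add (hDV.clm_apply (differentiableAt_const a))
      ((hBd.clm_apply had).clm_apply hV1), _root_.add_apply,
      fderiv_apply_apply hBd had hV1]
    have : fderiv ℝ (fun z ↦ christoffelL G' (F z)) y b =
        fderiv ℝ (christoffelL G') (F y) (fderiv ℝ F y b) := by
      rw [show (fun z ↦ christoffelL G' (F z)) = christoffelL G' ∘ F from rfl,
        fderiv_comp y hΓ hFd]
      rfl
    rw [this]
  rw [covAlong_eq h' hmap hy (fun z ↦ covAlong G' F V z v),
    covAlong_eq h' hmap hy (fun z ↦ covAlong G' F V z u), key, key, covAlong_eq h' hmap hy,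
    covAlong_eq h' hmap hy, h'.curvature_eq (hmap hy), hsec, fderiv_fderiv_map_symm hs hF hy u v]
  simp only [map_add]
  abel

end Along

end LocalGeometry

namespace LocalGeometry

/-! ### Gauss, Weingarten and Ricci equations of an isometric immersion -/

section Submanifold

variable {E E' : Type*} [NormedAddCommGroup E] [NormedSpace ℝ E]
  [NormedAddCommGroup E'] [NormedSpace ℝ E'] [FiniteDimensional ℝ E] [FiniteDimensional ℝ E']

/-- `F` is an isometric immersion of the open set `s` with metric `G` into the open set `s'` with
metric `G'`. -/
structure IsIsometricOn (G : E → E →L[ℝ] E →L[ℝ] ℝ) (G' : E' → E' →L[ℝ] E' →L[ℝ] ℝ) (F : E → E')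
    (s : Set E) (s' : Set E') : Prop where
  dom : IsMetricOn G s
  cod : IsMetricOn G' s'
  contDiffOn : ContDiffOn ℝ ∞ F s
  mapsTo : Set.MapsTo F s s'
  induced_eq : ∀ y ∈ s, induced G' F y = G y

namespace IsIsometricOn

variable {G : E → E →L[ℝ] E →L[ℝ] ℝ} {G' : E' → E' →L[ℝ] E' →L[ℝ] ℝ} {F : E → E'}
  {s : Set E} {s' : Set E'} (h : IsIsometricOn G G' F s s') {y : E} (hy : y ∈ s)
include h hy

theorem metric_apply (u v : E) : G y u v = G' (F y) (fderiv ℝ F y u) (fderiv ℝ F y v) := by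
  rw [← h.induced_eq y hy]
  rfl

theorem normalPart_eq (w : E') : normalPart G' F y w =
    w - fderiv ℝ F y ((G y).inverse ((G' (F y) w) ∘L fderiv ℝ F y)) := by
  rw [normalPart, h.induced_eq y hy]

theorem metric_tangentPart (w : E') (u : E) :
    G y ((G y).inverse ((G' (F y) w) ∘L fderiv ℝ F y)) u = G' (F y) w (fderiv ℝ F y u) := by
  rw [h.dom.apply_inverse hy]
  rfl

theorem metric_normalPart (w : E') (u : E) :
    G' (F y) (normalPart G' F y w) (fderiv ℝ F y u) = 0 := by
  rw [h.normalPart_eq hy, map_sub, _root_.sub_apply, ← h.metric_apply hy,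
    h.metric_tangentPart hy, sub_self]

theorem normalPart_add (w w' : E') :
    normalPart G' F y (w + w') = normalPart G' F y w + normalPart G' F y w' := by
  simp only [h.normalPart_eq hy, map_add, ContinuousLinearMap.add_comp]
  abel

theorem normalPart_sub (w w' : E') :
    normalPart G' F y (w - w') = normalPart G' F y w - normalPart G' F y w' := by
  simp only [h.normalPart_eq hy, map_sub, ContinuousLinearMap.sub_comp]
  abel

theorem normalPart_tangent (u : E) : normalPart G' F y (fderiv ℝ F y u) = 0 := by
  rw [h.normalPart_eq hy, sub_eq_zero]
  congr 1
  refine h.dom.ext_right hy fun w ↦ ?_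
  rw [h.metric_tangentPart hy, h.metric_apply hy]

theorem normalPart_of_normal {w : E'} (hw : ∀ u, G' (F y) w (fderiv ℝ F y u) = 0) :
    normalPart G' F y w = w := by
  have : (G' (F y) w) ∘L fderiv ℝ F y = 0 := by
    ext u
    exact hw u
  rw [h.normalPart_eq hy, this]
  simp

/-- The tangential part of the ambient derivative satisfies the Koszul formula of the induced
metric, being symmetric and metric compatible; positive definiteness leaves only one solution. -/
theorem tangentPart_covAlong (u v : E) :
    (G y).inverse ((G' (F y) (covAlong G' F (fun z ↦ fderiv ℝ F z v) y u)) ∘L fderiv ℝ F y) =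
      christoffelL G y u v := by
  have hcov (a b w : E) : fderiv ℝ G y a b w =
      G' (F y) (covAlong G' F (fun z ↦ fderiv ℝ F z b) y a) (fderiv ℝ F y w)
        + G' (F y) (fderiv ℝ F y b) (covAlong G' F (fun z ↦ fderiv ℝ F z w) y a) := by
    rw [← fderiv_inner_along h.cod h.dom.isOpen h.contDiffOn h.mapsTo hy
      ((contDiffAt_fderiv_map h.dom.isOpen h.contDiffOn hy b).differentiableAt (by simp))
      ((contDiffAt_fderiv_map h.dom.isOpen h.contDiffOn hy w).differentiableAt (by simp)),
      ← fderiv_const_apply_apply (h.dom.differentiableAt hy)]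
    have : (fun z ↦ G z b w) =ᶠ[𝓝 y] fun z ↦ G' (F z) (fderiv ℝ F z b) (fderiv ℝ F z w) := by
      filter_upwards [h.dom.eventually_mem hy] with z hz using h.metric_apply hz b w
    rw [this.fderiv_eq]
  have hsymm (a b : E) := covAlong_fderiv_symm h.cod h.dom.isOpen h.contDiffOn h.mapsTo hy a b
  refine h.dom.ext_right hy fun w ↦ ?_
  rw [h.metric_tangentPart hy, h.dom.christoffelL_spec hy, hcov, hcov, hcov, hsymm v u, hsymm w u,
    hsymm w v, h.cod.symm _ (h.mapsTo hy) (fderiv ℝ F y v),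
    h.cod.symm _ (h.mapsTo hy) (fderiv ℝ F y u)]
  ring

theorem covAlong_fderiv (u v : E) : covAlong G' F (fun z ↦ fderiv ℝ F z v) y u =
    fderiv ℝ F y (christoffelL G y u v) + secondFundamentalForm G' F y u v := by
  rw [secondFundamentalForm, h.normalPart_eq hy, h.tangentPart_covAlong hy]
  abel

theorem metric_secondFundamentalForm (u v w : E) :
    G' (F y) (secondFundamentalForm G' F y u v) (fderiv ℝ F y w) = 0 :=
  h.metric_normalPart hy _ _

theorem secondFundamentalForm_symm (u v : E) :
    secondFundamentalForm G' F y u v = secondFundamentalForm G' F y v u := by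
  rw [secondFundamentalForm, secondFundamentalForm,
    covAlong_fderiv_symm h.cod h.dom.isOpen h.contDiffOn h.mapsTo hy]

theorem covAlong_fderiv_eq (u v : E) : covAlong G' F (fun z ↦ fderiv ℝ F z v) y u =
    fderiv ℝ (fderiv ℝ F) y u v + christoffelL G' (F y) (fderiv ℝ F y u) (fderiv ℝ F y v) := by
  have hD : DifferentiableAt ℝ (fderiv ℝ F) y :=
    ((contDiffAt_map h.dom.isOpen h.contDiffOn hy).fderiv_right (m := 1)
      (by rw [one_add_one_eq_two]; exact two_le_infty)).differentiableAt (by simp)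
  rw [covAlong_eq h.cod h.mapsTo hy, (hD.hasFDerivAt.clm_apply (hasFDerivAt_const v y)).fderiv]
  simp

/-- Every term on the right is visibly linear in v, which is where linearity of the second
fundamental form comes from. -/
theorem secondFundamentalForm_eq (u v : E) : secondFundamentalForm G' F y u v =
    fderiv ℝ (fderiv ℝ F) y u v + christoffelL G' (F y) (fderiv ℝ F y u) (fderiv ℝ F y v)
      - fderiv ℝ F y (christoffelL G y u v) := by
  rw [← h.covAlong_fderiv_eq hy, h.covAlong_fderiv hy]
  abel

theorem secondFundamentalForm_add (u v v' : E) : secondFundamentalForm G' F y u (v + v') =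
    secondFundamentalForm G' F y u v + secondFundamentalForm G' F y u v' := by
  simp only [h.secondFundamentalForm_eq hy, map_add]
  abel

theorem secondFundamentalForm_smul (u v : E) (a : ℝ) : secondFundamentalForm G' F y u (a • v) =
    a • secondFundamentalForm G' F y u v := by
  simp only [h.secondFundamentalForm_eq hy, map_smul, smul_sub, smul_add]

theorem covAlong_add {V W : E → E'} (hV : DifferentiableAt ℝ V y) (hW : DifferentiableAt ℝ W y)
    (u : E) : covAlong G' F (fun z ↦ V z + W z) y u = covAlong G' F V y u + covAlong G' F W y u := by
  simp only [covAlong_eq h.cod h.mapsTo hy, fderiv_fun_add hV hW, map_add, _root_.add_apply]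
  abel

theorem covAlong_congr {V W : E → E'} (hVW : ∀ z ∈ s, V z = W z) (u : E) :
    covAlong G' F V y u = covAlong G' F W y u := by
  have : V =ᶠ[𝓝 y] W := by
    filter_upwards [h.dom.eventually_mem hy] with z hz using hVW z hz
  rw [covAlong, covAlong, this.fderiv_eq, hVW y hy]

/-- The Gauss formula for the tangential field `dF(X)`. -/
theorem covAlong_tangent {X : E → E} (hX : DifferentiableAt ℝ X y) (u : E) :
    covAlong G' F (fun z ↦ fderiv ℝ F z (X z)) y u =
      fderiv ℝ F y (fderiv ℝ X y u + christoffelL G y u (X y))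
        + secondFundamentalForm G' F y u (X y) := by
  have hD : DifferentiableAt ℝ (fderiv ℝ F) y :=
    ((contDiffAt_map h.dom.isOpen h.contDiffOn hy).fderiv_right (m := 1)
      (by rw [one_add_one_eq_two]; exact two_le_infty)).differentiableAt (by simp)
  have := h.covAlong_fderiv hy u (X y)
  rw [h.covAlong_fderiv_eq hy] at this
  rw [covAlong_eq h.cod h.mapsTo hy, (hD.hasFDerivAt.clm_apply hX.hasFDerivAt).fderiv, map_add,
    add_assoc, ← this]
  simp
  abel

theorem differentiableAt_tangent {X : E → E} (hX : DifferentiableAt ℝ X y) :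
    DifferentiableAt ℝ (fun z ↦ fderiv ℝ F z (X z)) y :=
  (((contDiffAt_map h.dom.isOpen h.contDiffOn hy).fderiv_right (m := 1)
      (by rw [one_add_one_eq_two]; exact two_le_infty)).differentiableAt (by simp)).clm_apply hX

theorem differentiableAt_christoffelL (v w : E) :
    DifferentiableAt ℝ (fun z ↦ christoffelL G z v w) y :=
  ((h.dom.differentiableAt_christoffelL hy).clm_apply (differentiableAt_const v)).clm_apply
    (differentiableAt_const w)

theorem differentiableAt_secondFundamentalForm (v w : E) :
    DifferentiableAt ℝ (fun z ↦ secondFundamentalForm G' F z v w) y := by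
  have hev : (fun z ↦ secondFundamentalForm G' F z v w) =ᶠ[𝓝 y]
      fun z ↦ covAlong G' F (fun z ↦ fderiv ℝ F z w) z v
        - fderiv ℝ F z (christoffelL G z v w) := by
    filter_upwards [h.dom.eventually_mem hy] with z hz
    rw [h.covAlong_fderiv hz]
    abel
  refine DifferentiableAt.congr_of_eventuallyEq ?_ hev
  refine DifferentiableAt.sub ?_ (h.differentiableAt_tangent hy
    (h.differentiableAt_christoffelL hy v w))
  exact (contDiffAt_covAlong (k := 1) h.cod h.dom.isOpen h.contDiffOn h.mapsTo hy
    ((contDiffAt_fderiv_map h.dom.isOpen h.contDiffOn hy w).of_le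
      (by
      change (1 + 1 : WithTop ℕ∞) ≤ ∞
      rw [one_add_one_eq_two]
      exact two_le_infty)) v).differentiableAt (by simp)

/-- The Weingarten formula. -/
theorem metric_covAlong_normal {N : E → E'} (hN : DifferentiableAt ℝ N y)
    (hn : ∀ z ∈ s, ∀ u, G' (F z) (N z) (fderiv ℝ F z u) = 0) (u w : E) :
    G' (F y) (covAlong G' F N y u) (fderiv ℝ F y w) =
      - G' (F y) (N y) (secondFundamentalForm G' F y u w) := by
  have h0 := fderiv_inner_along h.cod h.dom.isOpen h.contDiffOn h.mapsTo hy hN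
    ((contDiffAt_fderiv_map h.dom.isOpen h.contDiffOn hy w).differentiableAt (by simp)) u
  have hev : (fun z ↦ G' (F z) (N z) (fderiv ℝ F z w)) =ᶠ[𝓝 y] fun _ ↦ (0 : ℝ) := by
    filter_upwards [h.dom.eventually_mem hy] with z hz using hn z hz w
  rw [hev.fderiv_eq, h.covAlong_fderiv hy, map_add, hn y hy] at h0
  simp at h0
  linarith

/-- The Gauss equation. -/
theorem gauss_equation (u v w x : E) :
    G y (curvature G y u v w) x =
      G' (F y) (curvature G' (F y) (fderiv ℝ F y u) (fderiv ℝ F y v) (fderiv ℝ F y w))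
        (fderiv ℝ F y x)
      + G' (F y) (secondFundamentalForm G' F y v w) (secondFundamentalForm G' F y u x)
      - G' (F y) (secondFundamentalForm G' F y u w) (secondFundamentalForm G' F y v x) := by
  -- The Gauss formula splits the inner derivative into the tangential field `dF(Γ(b, w))` and the
  -- normal field `σ(b, w)`. After a second differentiation the normal field contributes to the
  -- tangential component by the Weingarten formula only.
  have key (a b : E) :
      G' (F y) (covAlong G' F (fun z ↦ covAlong G' F (fun z ↦ fderiv ℝ F z w) z b) y a)
        (fderiv ℝ F y x) =
      G y (fderiv ℝ (christoffelL G) y a b w + christoffelL G y a (christoffelL G y b w)) x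
        - G' (F y) (secondFundamentalForm G' F y b w) (secondFundamentalForm G' F y a x) := by
    rw [h.covAlong_congr hy (W := fun z ↦ fderiv ℝ F z (christoffelL G z b w)
        + secondFundamentalForm G' F z b w) (fun z hz ↦ h.covAlong_fderiv hz b w) a,
      h.covAlong_add hy (h.differentiableAt_tangent hy (h.differentiableAt_christoffelL hy b w))
        (h.differentiableAt_secondFundamentalForm hy b w),
      h.covAlong_tangent hy (h.differentiableAt_christoffelL hy b w), map_add, map_add,
      _root_.add_apply, _root_.add_apply, ← h.metric_apply hy,
      h.metric_secondFundamentalForm hy,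
      h.metric_covAlong_normal hy (h.differentiableAt_secondFundamentalForm hy b w)
        (fun z hz ↦ h.metric_secondFundamentalForm hz b w),
      fderiv_const_apply_apply (h.dom.differentiableAt_christoffelL hy)]
    ring
  rw [← covAlong_covAlong_sub h.cod h.dom.isOpen h.contDiffOn h.mapsTo hy
    ((contDiffAt_fderiv_map h.dom.isOpen h.contDiffOn hy w).of_le two_le_infty) u v,
    map_sub, _root_.sub_apply, key, key, h.dom.curvature_eq hy]
  simp only [map_add, map_sub, _root_.sub_apply, _root_.add_apply]
  ring

/-- The Ricci equation, in terms of the tangential parts of `∇̃_u N` and `∇̃_v N`. -/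
theorem ricci_equation {N : E → E'} (hN : ∀ z ∈ s, ContDiffAt ℝ 2 N z)
    (hn : ∀ z ∈ s, ∀ u, G' (F z) (N z) (fderiv ℝ F z u) = 0) (u v : E) :
    ∃ t : E → E, (∀ a w, G y (t a) w =
        - G' (F y) (N y) (secondFundamentalForm G' F y a w)) ∧
      normalCurvature G' F N y u v =
        normalPart G' F y (curvature G' (F y) (fderiv ℝ F y u) (fderiv ℝ F y v) (N y))
          - secondFundamentalForm G' F y u (t v) + secondFundamentalForm G' F y v (t u) := by
  -- The tangential part of the ambient derivative of N in direction a; by the Weingarten formula it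
  -- is `-A_N a`.
  let t (a z : E) : E := (G z).inverse ((G' (F z) (covAlong G' F N z a)) ∘L fderiv ℝ F z)
  have hcov (a z : E) (hz : z ∈ s) :
      covAlong G' F N z a = fderiv ℝ F z (t a z) + normalCov G' F N z a := by
    rw [normalCov, h.normalPart_eq hz]
    abel
  have hdcov (a : E) : DifferentiableAt ℝ (fun z ↦ covAlong G' F N z a) y :=
    (contDiffAt_covAlong (k := 1) h.cod h.dom.isOpen h.contDiffOn h.mapsTo hy
      ((hN y hy).of_le (by norm_num)) a).differentiableAt (by simp)
  have hFd : DifferentiableAt ℝ F y :=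
    (contDiffAt_map h.dom.isOpen h.contDiffOn hy).differentiableAt (by simp)
  have hdF : DifferentiableAt ℝ (fderiv ℝ F) y :=
    ((contDiffAt_map h.dom.isOpen h.contDiffOn hy).fderiv_right (m := 1)
      (by rw [one_add_one_eq_two]; exact two_le_infty)).differentiableAt (by simp)
  have hdt (a : E) : DifferentiableAt ℝ (t a) y := by
    have h1 : DifferentiableAt ℝ (fun z ↦ G' (F z)) y :=
      (h.cod.differentiableAt (h.mapsTo hy)).comp y hFd
    exact ((h.dom.contDiffAt_inverse hy).differentiableAt (by simp)).clm_apply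
      ((h1.clm_apply (hdcov a)).clm_comp hdF)
  have hdn (a : E) : DifferentiableAt ℝ (fun z ↦ normalCov G' F N z a) y := by
    have hev : (fun z ↦ normalCov G' F N z a) =ᶠ[𝓝 y]
        fun z ↦ covAlong G' F N z a - fderiv ℝ F z (t a z) := by
      filter_upwards [h.dom.eventually_mem hy] with z hz
      rw [hcov a z hz]
      abel
    exact ((hdcov a).sub (h.differentiableAt_tangent hy (hdt a))).congr_of_eventuallyEq hev
  refine ⟨fun a ↦ t a y, fun a w ↦ ?_, ?_⟩
  · rw [h.metric_tangentPart hy,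
      h.metric_covAlong_normal hy ((hN y hy).differentiableAt (by simp)) hn]
  -- Differentiating the tangential field `dF(t b)` again leaves `σ(a, t b)` as its normal part, by
  -- the Gauss formula.
  · have key (a b : E) :
        normalPart G' F y (covAlong G' F (fun z ↦ covAlong G' F N z b) y a) =
          secondFundamentalForm G' F y a (t b y)
            + normalCov G' F (fun z ↦ normalCov G' F N z b) y a := by
      rw [h.covAlong_congr hy (hcov b) a,
        h.covAlong_add hy (h.differentiableAt_tangent hy (hdt b)) (hdn b),
        h.covAlong_tangent hy (hdt b), h.normalPart_add hy, h.normalPart_add hy,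
        h.normalPart_tangent hy, zero_add,
        h.normalPart_of_normal hy (h.metric_secondFundamentalForm hy a (t b y))]
      rfl
    rw [← covAlong_covAlong_sub h.cod h.dom.isOpen h.contDiffOn h.mapsTo hy (hN y hy) u v,
      h.normalPart_sub hy, key, key, normalCurvature]
    abel

end IsIsometricOn

end Submanifold

/-! ### Symmetries of the coordinate curvature -/

section CurvatureSymmetries

variable {E : Type*} [NormedAddCommGroup E] [NormedSpace ℝ E] [FiniteDimensional ℝ E]
  {G : E → E →L[ℝ] E →L[ℝ] ℝ} {s : Set E}

namespace IsMetricOn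

variable (h : IsMetricOn G s) {y : E} (hy : y ∈ s)
include h hy

/-- Only the symmetry of the Christoffel symbols, also after differentiation, is needed: the cyclic
sum then cancels in pairs. -/
theorem curvature_bianchi (u v w : E) :
    curvature G y u v w + curvature G y v w u + curvature G y w u v = 0 := by
  have hΓ (a b c : E) :
      fderiv ℝ (christoffelL G) y a b c = fderiv ℝ (christoffelL G) y a c b := by
    rw [← fderiv_const_apply_apply (h.differentiableAt_christoffelL hy),
      ← fderiv_const_apply_apply (h.differentiableAt_christoffelL hy)]
    have : (fun z ↦ christoffelL G z b c) =ᶠ[𝓝 y] fun z ↦ christoffelL G z c b := by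
      filter_upwards [h.eventually_mem hy] with z hz using h.christoffelL_symm hz b c
    rw [this.fderiv_eq]
  simp only [h.curvature_eq hy]
  rw [hΓ v u w, hΓ w v u, hΓ u w v, h.christoffelL_symm hy u w, h.christoffelL_symm hy v u,
    h.christoffelL_symm hy w v]
  abel

/-- Second derivatives of the function `G(w, x)` commute. Expanded by metric compatibility, with
constant fields along the identity map, their mixed first-order terms are symmetric in the two
directions and drop out, leaving the two curvature terms. -/
theorem metric_curvature_antisymm (u v w x : E) :
    G y (curvature G y u v w) x = - G y (curvature G y u v x) w := by
  have hid : ContDiffOn ℝ ∞ (id : E → E) s := contDiffOn_id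
  have hmap : Set.MapsTo (id : E → E) s s := Set.mapsTo_id s
  have hd (a b : E) : ContDiffAt ℝ 1 (fun z ↦ covAlong G id (fun _ ↦ a) z b) y :=
    contDiffAt_covAlong (k := 1) h h.isOpen hid hmap hy contDiffAt_const b
  have hdd (a b : E) : DifferentiableAt ℝ (fun z ↦ covAlong G id (fun _ ↦ a) z b) y :=
    (hd a b).differentiableAt (by simp)
  have hGd := h.differentiableAt hy
  have key (a b : E) : fderiv ℝ (fun z ↦ fderiv ℝ (fun z ↦ G z w x) z b) y a =
      G y (covAlong G id (fun z ↦ covAlong G id (fun _ ↦ w) z b) y a) x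
        + G y (covAlong G id (fun _ ↦ w) y b) (covAlong G id (fun _ ↦ x) y a)
        + (G y (covAlong G id (fun _ ↦ w) y a) (covAlong G id (fun _ ↦ x) y b)
        + G y w (covAlong G id (fun z ↦ covAlong G id (fun _ ↦ x) z b) y a)) := by
    have hev : (fun z ↦ fderiv ℝ (fun z ↦ G z w x) z b) =ᶠ[𝓝 y]
        fun z ↦ G z (covAlong G id (fun _ ↦ w) z b) x
          + G z w (covAlong G id (fun _ ↦ x) z b) := by
      filter_upwards [h.eventually_mem hy] with z hz
      exact fderiv_inner_along h h.isOpen hid hmap hz (differentiableAt_const w)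
        (differentiableAt_const x) b
    rw [hev.fderiv_eq, fderiv_fun_add ((hGd.clm_apply (hdd w b)).clm_apply
      (differentiableAt_const x)) ((hGd.clm_apply (differentiableAt_const w)).clm_apply (hdd x b)),
      _root_.add_apply]
    congr 1
    · exact fderiv_inner_along h h.isOpen hid hmap hy (hdd w b) (differentiableAt_const x) a
    · exact fderiv_inner_along h h.isOpen hid hmap hy (differentiableAt_const w) (hdd x b) a
  have hC : ContDiffAt ℝ 2 (fun z ↦ G z w x) y :=
    (((h.contDiffAt hy).clm_apply contDiffAt_const).clm_apply contDiffAt_const).of_le two_le_infty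
  have hD : DifferentiableAt ℝ (fderiv ℝ fun z ↦ G z w x) y :=
    (hC.fderiv_right (m := 1) (by norm_num)).differentiableAt (by simp)
  have hsec : fderiv ℝ (fun z ↦ fderiv ℝ (fun z ↦ G z w x) z v) y u =
      fderiv ℝ (fun z ↦ fderiv ℝ (fun z ↦ G z w x) z u) y v := by
    have h1 (a b : E) : fderiv ℝ (fun z ↦ fderiv ℝ (fun z ↦ G z w x) z a) y b =
        fderiv ℝ (fderiv ℝ fun z ↦ G z w x) y b a := by
      rw [(hD.hasFDerivAt.clm_apply (hasFDerivAt_const a y)).fderiv]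
      simp
    rw [h1, h1]
    exact (hC.isSymmSndFDerivAt (by simp)).eq u v
  have hR (a : E) : covAlong G id (fun z ↦ covAlong G id (fun _ ↦ a) z v) y u
      - covAlong G id (fun z ↦ covAlong G id (fun _ ↦ a) z u) y v = curvature G y u v a := by
    rw [covAlong_covAlong_sub h h.isOpen hid hmap hy contDiffAt_const]
    simp
  rw [key, key] at hsec
  rw [h.symm y hy _ w, ← hR w, ← hR x]
  simp only [map_sub, _root_.sub_apply]
  linarith

end IsMetricOn

end CurvatureSymmetries

end LocalGeometry

/-! ### Algebraic curvature tensors and constant sectional curvature -/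

section CurvatureLike

variable {V : Type*} [NormedAddCommGroup V] [InnerProductSpace ℝ V]

/-- The algebraic symmetries of a Riemann curvature tensor. -/
structure IsCurvatureLike (R : V → V → V → V → ℝ) : Prop where
  add_left : ∀ x x' y z w, R (x + x') y z w = R x y z w + R x' y z w
  smul_left : ∀ (a : ℝ) x y z w, R (a • x) y z w = a * R x y z w
  antisymm_left : ∀ x y z w, R x y z w = - R y x z w
  antisymm_right : ∀ x y z w, R x y z w = - R x y w z
  bianchi : ∀ x y z w, R x y z w + R y z x w + R z x y w = 0

namespace IsCurvatureLike

variable {R : V → V → V → V → ℝ} (h : IsCurvatureLike R)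
include h

/-- Milnor's octahedron argument: combine the Bianchi identities for the four cyclic shifts of the
arguments, using both antisymmetries. -/
theorem pair_symm (x y z w : V) : R x y z w = R z w x y := by
  have := h.bianchi x y z w
  have := h.bianchi y z w x
  have := h.bianchi z w x y
  have := h.bianchi w x y z
  have := h.antisymm_right y z w x
  have := h.antisymm_right z w y x
  have := h.antisymm_right w y z x
  have := h.antisymm_right w x z y
  have := h.antisymm_right x z w y
  have := h.antisymm_right x y w z
  have := h.antisymm_left y z x w
  have := h.antisymm_left z x y w
  have := h.antisymm_left x z y w
  have := h.antisymm_left x z w y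
  have := h.antisymm_left w y x z
  have := h.antisymm_left w y z x
  have := h.antisymm_left z w x y
  have := h.antisymm_right w x y z
  have := h.antisymm_right z w x y
  have := h.antisymm_right y z x w
  linarith

/-- Polarizing in y and then in x makes R alternate in its outer arguments as well. It is then
invariant under cyclic shifts of the first three arguments, so the Bianchi identity reads 3R = 0. -/
theorem eq_zero (h0 : ∀ x y, R x y y x = 0) (x y z w : V) : R x y z w = 0 := by
  have add1 := h.add_left
  have add2 (x y y' z w : V) : R x (y + y') z w = R x y z w + R x y' z w := by
    rw [h.antisymm_left, add1, h.antisymm_left y, h.antisymm_left y']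
    ring
  have add3 (x y z z' w : V) : R x y (z + z') w = R x y z w + R x y z' w := by
    rw [h.pair_symm, add1, h.pair_symm z, h.pair_symm z']
  have add4 (x y z w w' : V) : R x y z (w + w') = R x y z w + R x y z w' := by
    rw [h.pair_symm, add2, h.pair_symm z w, h.pair_symm z w']
  have h1 (x y z : V) : R x y z x = 0 := by
    have e1 := h0 x (y + z)
    rw [add2, add3, add3, h0, h0] at e1
    have e2 := h.pair_symm x z y x
    have e3 := h.antisymm_left y x x z
    have e4 := h.antisymm_right x y x z
    linarith
  have h2 (x y z w : V) : R x y z w = - R w y z x := by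
    have e1 := h1 (x + w) y z
    rw [add1, add4, add4, h1, h1] at e1
    linarith
  have e1 : R y z x w = R x y z w := by
    rw [h.pair_symm, h2, h.antisymm_left, h.pair_symm, h.antisymm_left y, h.antisymm_right x y w]
    ring
  have e2 : R z x y w = R x y z w := by
    rw [h.pair_symm, h2, h.antisymm_left, h.pair_symm, h.antisymm_left z, h.antisymm_right y z w, e1]
    ring
  have := h.bianchi x y z w
  linarith

/-- The difference T with the constant curvature model is again curvature-like and vanishes on
orthonormal pairs. Scaling extends this to orthogonal pairs, and subtracting from y its projection
to x extends it to all pairs; then `eq_zero` applies. -/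
theorem eq_of_sectional_eq {c : ℝ}
    (hc : ∀ x y : V, ‖x‖ = 1 → ‖y‖ = 1 → ⟪x, y⟫ = 0 → R x y y x = c) (x y z w : V) :
    R x y z w = c * (⟪y, z⟫ * ⟪x, w⟫ - ⟪x, z⟫ * ⟪y, w⟫) := by
  set T : V → V → V → V → ℝ := fun x y z w ↦
    R x y z w - c * (⟪y, z⟫ * ⟪x, w⟫ - ⟪x, z⟫ * ⟪y, w⟫) with hT
  have hT' : IsCurvatureLike T := by
    constructor
    · intro x x' y z w
      simp only [hT, h.add_left, inner_add_left]
      ring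
    · intro a x y z w
      simp only [hT, h.smul_left, inner_smul_left]
      simp
      ring
    · intro x y z w
      simp only [hT]
      rw [h.antisymm_left x y]
      ring
    · intro x y z w
      simp only [hT]
      rw [h.antisymm_right x y]
      ring
    · intro x y z w
      simp only [hT]
      rw [real_inner_comm x y, real_inner_comm x z, real_inner_comm y z]
      linear_combination h.bianchi x y z w
  have smul2 (a : ℝ) (x y z w : V) : T x (a • y) z w = a * T x y z w := by
    rw [hT'.antisymm_left, hT'.smul_left, hT'.antisymm_left y]
    ring
  have smul3 (a : ℝ) (x y z w : V) : T x y (a • z) w = a * T x y z w := by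
    rw [hT'.pair_symm, hT'.smul_left, hT'.pair_symm z]
  have smul4 (a : ℝ) (x y z w : V) : T x y z (a • w) = a * T x y z w := by
    rw [hT'.pair_symm, smul2, hT'.pair_symm z w]
  have self1 (x z w : V) : T x x z w = 0 := by
    have := hT'.antisymm_left x x z w
    linarith
  have self2 (x y z : V) : T x y z z = 0 := by
    have := hT'.antisymm_right x y z z
    linarith
  have zero1 (y z w : V) : T 0 y z w = 0 := by simpa using hT'.smul_left 0 0 y z w
  have zero2 (x z w : V) : T x 0 z w = 0 := by simpa using smul2 0 x 0 z w
  have horth (x z : V) (hxz : ⟪x, z⟫ = 0) : T x z z x = 0 := by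
    rcases eq_or_ne x 0 with rfl | hx
    · exact zero1 _ _ _
    rcases eq_or_ne z 0 with rfl | hz
    · exact zero2 _ _ _
    have hu (v : V) (hv : v ≠ 0) : ‖(‖v‖⁻¹ : ℝ) • v‖ = 1 := by
      rw [norm_smul, norm_inv, norm_norm, inv_mul_cancel₀ (norm_ne_zero_iff.2 hv)]
    have hin (v : V) (hv : ‖v‖ = 1) : ⟪v, v⟫ = 1 := by
      rw [real_inner_self_eq_norm_sq, hv]
      norm_num
    have hoo : ⟪(‖x‖⁻¹ : ℝ) • x, (‖z‖⁻¹ : ℝ) • z⟫ = 0 := by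
      simp [inner_smul_left, inner_smul_right, hxz]
    have e : T ((‖x‖⁻¹ : ℝ) • x) ((‖z‖⁻¹ : ℝ) • z) ((‖z‖⁻¹ : ℝ) • z) ((‖x‖⁻¹ : ℝ) • x) = 0 := by
      simp only [hT]
      rw [hc _ _ (hu x hx) (hu z hz) hoo, hin _ (hu x hx), hin _ (hu z hz), hoo]
      ring
    rw [hT'.smul_left, smul2, smul3, smul4] at e
    have hx' := norm_ne_zero_iff.2 hx
    have hz' := norm_ne_zero_iff.2 hz
    simpa [hx', hz'] using e
  have hall (x y : V) : T x y y x = 0 := by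
    rcases eq_or_ne x 0 with rfl | hx
    · exact zero1 _ _ _
    set a : ℝ := ⟪x, y⟫ / ⟪x, x⟫
    have hxx : ⟪x, x⟫ ≠ 0 := inner_self_ne_zero.2 hx
    have hz : ⟪x, y - a • x⟫ = 0 := by
      rw [inner_sub_right, inner_smul_right, div_mul_cancel₀ _ hxx, sub_self]
    have hy : y = a • x + (y - a • x) := by abel
    have e := horth x _ hz
    have add2 (x y y' z w : V) : T x (y + y') z w = T x y z w + T x y' z w := by
      rw [hT'.antisymm_left, hT'.add_left, hT'.antisymm_left y, hT'.antisymm_left y']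
      ring
    have add3 (x y z z' w : V) : T x y (z + z') w = T x y z w + T x y z' w := by
      rw [hT'.pair_symm, hT'.add_left, hT'.pair_symm z, hT'.pair_symm z']
    rw [hy, add2, add3, add3, smul2, smul2, self1, self1, smul3, self2, e]
    ring
  have := hT'.eq_zero hall x y z w
  simp only [hT] at this
  linarith

end IsCurvatureLike

end CurvatureLike

/-! ### Basis-independent sums and the weighted Cauchy–Schwarz inequality -/

section BilinearSums

variable {V W : Type*} [NormedAddCommGroup V] [InnerProductSpace ℝ V]
  [NormedAddCommGroup W] [InnerProductSpace ℝ W]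

theorem OrthonormalBasis.sum_bilin_self_eq {X : Type*} [AddCommGroup X] [Module ℝ X]
    {ι ι' : Type*} [Fintype ι] [Fintype ι'] (b : OrthonormalBasis ι ℝ V)
    (b' : OrthonormalBasis ι' ℝ V) (Q : V →ₗ[ℝ] V →ₗ[ℝ] X) :
    ∑ i, Q (b i) (b i) = ∑ i, Q (b' i) (b' i) := by
  classical
  have h1 (i : ι) : Q (b i) (b i) = ∑ j, ∑ k, (⟪b' j, b i⟫ * ⟪b i, b' k⟫) • Q (b' j) (b' k) := by
    conv_lhs => rw [← b'.sum_repr' (b i)]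
    simp only [map_sum, LinearMap.sum_apply, map_smul, LinearMap.smul_apply, Finset.smul_sum,
      smul_smul]
    rw [Finset.sum_comm]
    simp only [real_inner_comm (b i)]
    refine Finset.sum_congr rfl fun j _ ↦ Finset.sum_congr rfl fun k _ ↦ ?_
    rw [mul_comm]
  simp only [h1]
  rw [Finset.sum_comm]
  refine Finset.sum_congr rfl fun j _ ↦ ?_
  rw [Finset.sum_comm]
  simp only [← Finset.sum_smul, b.sum_inner_mul_inner]
  simp [orthonormal_iff_ite.1 b'.orthonormal]

/-- The squared norm of a vector valued bilinear form with respect to a family of vectors. -/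
def sumNormSq (σ : V →ₗ[ℝ] V →ₗ[ℝ] W) {ι : Type*} [Fintype ι] (b : ι → V) : ℝ :=
  ∑ i, ∑ j, ‖σ (b i) (b j)‖ ^ 2

theorem OrthonormalBasis.sum_norm_sq_eq {ι ι' : Type*} [Fintype ι] [Fintype ι']
    (b : OrthonormalBasis ι ℝ V) (b' : OrthonormalBasis ι' ℝ V) (l : V →ₗ[ℝ] W) :
    ∑ i, ‖l (b i)‖ ^ 2 = ∑ i, ‖l (b' i)‖ ^ 2 := by
  have := b.sum_bilin_self_eq b' ((innerₗ W).compl₁₂ l l)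
  simpa [real_inner_self_eq_norm_sq] using this

/-- The basis is changed one slot at a time, through `σ` and `σ.flip`. This frees the Casorati
curvatures from the standard bases in their definitions. -/
theorem sumNormSq_eq (σ : V →ₗ[ℝ] V →ₗ[ℝ] W) {ι ι' : Type*} [Fintype ι] [Fintype ι']
    (b : OrthonormalBasis ι ℝ V) (b' : OrthonormalBasis ι' ℝ V) :
    sumNormSq σ b = sumNormSq σ b' := by
  unfold sumNormSq
  simp only [fun x ↦ b.sum_norm_sq_eq b' (σ x)]
  exact Finset.sum_comm.trans ((Finset.sum_congr rfl fun j _ ↦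
    b.sum_norm_sq_eq b' (σ.flip (b' j))).trans Finset.sum_comm)

/-- Cauchy–Schwarz with weights √2 on each x_i and 1 on g, whose squares sum to 2k + 1; the extra
term on the left records the defect from x_i = 2g. Substituting x_i = y_i + 2g cancels all terms in
g, and ‖Σ y_i‖² ≤ k Σ ‖y_i‖² remains. -/
theorem norm_sum_add_sq_le {k : ℕ} (x : Fin k → W) (g : W) :
    ‖∑ i, x i + g‖ ^ 2 + 1 / 2 * ∑ i, ‖x i - (2 : ℝ) • g‖ ^ 2 ≤
      (2 * k + 1) * (1 / 2 * ∑ i, ‖x i‖ ^ 2 + ‖g‖ ^ 2) := by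
  set y : Fin k → W := fun i ↦ x i - (2 : ℝ) • g with hy
  have hx (i : Fin k) : x i = y i + (2 : ℝ) • g := by simp [hy]
  have h1 : ‖∑ i, y i‖ ^ 2 ≤ k * ∑ i, ‖y i‖ ^ 2 := by
    refine (pow_le_pow_left₀ (norm_nonneg _) (norm_sum_le _ _) 2).trans ?_
    simpa using sq_sum_le_card_mul_sum_sq (s := Finset.univ) (f := fun i ↦ ‖y i‖)
  have h2 : ∑ i, ‖x i‖ ^ 2 = ∑ i, ‖y i‖ ^ 2 + 4 * ⟪∑ i, y i, g⟫ + 4 * k * ‖g‖ ^ 2 := by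
    simp only [hx, norm_add_sq_real, inner_smul_right, norm_smul, mul_pow, Finset.sum_add_distrib,
      sum_inner, ← Finset.mul_sum]
    simp
    ring
  have h3 : ∑ i, x i + g = ∑ i, y i + ((2 * k + 1 : ℝ)) • g := by
    simp only [hx, Finset.sum_add_distrib, Finset.sum_const, Finset.card_univ, Fintype.card_fin]
    rw [← Nat.cast_smul_eq_nsmul ℝ, smul_smul, add_assoc]
    congr 1
    module
  have h4 : ‖∑ i, x i + g‖ ^ 2 =
      ‖∑ i, y i‖ ^ 2 + 2 * ((2 * k + 1) * ⟪∑ i, y i, g⟫) + (2 * k + 1) ^ 2 * ‖g‖ ^ 2 := by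
    rw [h3, norm_add_sq_real, inner_smul_right, norm_smul, mul_pow, Real.norm_eq_abs, sq_abs]
  rw [h4, h2]
  linarith

end BilinearSums

/-! ### The Casorati inequality for a symmetric bilinear form -/

section Casorati

variable {V W : Type*} [NormedAddCommGroup V] [InnerProductSpace ℝ V]
  [NormedAddCommGroup W] [InnerProductSpace ℝ W] {k : ℕ}

/-- The form `σ` is diagonal in the basis `b`, with equal diagonal entries but for the last one,
which is half of the others. -/
def IsHalfUmbilicalBasis (σ : V →ₗ[ℝ] V →ₗ[ℝ] W) (b : OrthonormalBasis (Fin (k + 1)) ℝ V) : Prop :=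
  (∀ i j, i ≠ j → σ (b i) (b j) = 0) ∧
    ∀ i : Fin k, σ (b i.castSucc) (b i.castSucc) = (2 : ℝ) • σ (b (Fin.last k)) (b (Fin.last k))

theorem sumNormSq_castSucc_add {σ : V →ₗ[ℝ] V →ₗ[ℝ] W} (hσ : ∀ x y, σ x y = σ y x)
    (b : OrthonormalBasis (Fin (k + 1)) ℝ V) :
    sumNormSq σ b = sumNormSq σ (fun i : Fin k ↦ b i.castSucc)
      + 2 * ∑ i : Fin k, ‖σ (b (Fin.last k)) (b i.castSucc)‖ ^ 2
      + ‖σ (b (Fin.last k)) (b (Fin.last k))‖ ^ 2 := by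
  simp only [sumNormSq, Fin.sum_univ_castSucc, Finset.sum_add_distrib,
    fun i : Fin k ↦ hσ (b i.castSucc) (b (Fin.last k))]
  ring

theorem sumNormSq_eq_diag_add (σ : V →ₗ[ℝ] V →ₗ[ℝ] W) (b : Fin k → V) :
    sumNormSq σ b = ∑ i, ‖σ (b i) (b i)‖ ^ 2
      + ∑ i, ∑ j ∈ Finset.univ.erase i, ‖σ (b i) (b j)‖ ^ 2 := by
  rw [sumNormSq, ← Finset.sum_add_distrib]
  exact Finset.sum_congr rfl fun i _ ↦
    (Finset.add_sum_erase _ (fun j ↦ ‖σ (b i) (b j)‖ ^ 2) (Finset.mem_univ i)).symm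

/-- The inequality keeps explicit nonnegative remainders: deviation of the diagonal entries from 2g,
off-diagonal entries inside the hyperplane, and entries mixing it with the last vector. Their
vanishing is what the equality case needs. -/
theorem norm_trace_sq_le {σ : V →ₗ[ℝ] V →ₗ[ℝ] W} (hσ : ∀ x y, σ x y = σ y x)
    (b : OrthonormalBasis (Fin (k + 1)) ℝ V) :
    ‖∑ i, σ (b i) (b i)‖ ^ 2
        + (2 * k + 1) / 2 * sumNormSq σ (fun i : Fin k ↦ b i.castSucc)
        + (1 / 2 * ∑ i : Fin k, ‖σ (b i.castSucc) (b i.castSucc)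
            - (2 : ℝ) • σ (b (Fin.last k)) (b (Fin.last k))‖ ^ 2
          + 1 / 2 * ∑ i : Fin k, ∑ j ∈ Finset.univ.erase i, ‖σ (b i.castSucc) (b j.castSucc)‖ ^ 2
          + 2 * ∑ i : Fin k, ‖σ (b (Fin.last k)) (b i.castSucc)‖ ^ 2) ≤
      (2 * k + 1) * sumNormSq σ b := by
  rw [sumNormSq_castSucc_add hσ, sumNormSq_eq_diag_add σ (fun i : Fin k ↦ b i.castSucc),
    Fin.sum_univ_castSucc]
  have h1 := norm_sum_add_sq_le (fun i : Fin k ↦ σ (b i.castSucc) (b i.castSucc))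
    (σ (b (Fin.last k)) (b (Fin.last k)))
  have h2 : 0 ≤ ∑ i : Fin k, ∑ j ∈ Finset.univ.erase i, ‖σ (b i.castSucc) (b j.castSucc)‖ ^ 2 := by
    positivity
  have h3 : 0 ≤ ∑ i : Fin k, ‖σ (b (Fin.last k)) (b i.castSucc)‖ ^ 2 := by positivity
  have hk : (0 : ℝ) ≤ k := by positivity
  nlinarith [mul_nonneg hk h2, mul_nonneg hk h3]

theorem norm_trace_sq_le' {σ : V →ₗ[ℝ] V →ₗ[ℝ] W} (hσ : ∀ x y, σ x y = σ y x)
    (b : OrthonormalBasis (Fin (k + 1)) ℝ V) :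
    ‖∑ i, σ (b i) (b i)‖ ^ 2
        + (2 * k + 1) / 2 * sumNormSq σ (fun i : Fin k ↦ b i.castSucc) ≤
      (2 * k + 1) * sumNormSq σ b := by
  refine le_trans (le_add_of_nonneg_right ?_) (norm_trace_sq_le hσ b)
  positivity

theorem norm_trace_sq_eq_iff {σ : V →ₗ[ℝ] V →ₗ[ℝ] W} (hσ : ∀ x y, σ x y = σ y x)
    (b : OrthonormalBasis (Fin (k + 1)) ℝ V) :
    ‖∑ i, σ (b i) (b i)‖ ^ 2
        + (2 * k + 1) / 2 * sumNormSq σ (fun i : Fin k ↦ b i.castSucc) =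
      (2 * k + 1) * sumNormSq σ b ↔ IsHalfUmbilicalBasis σ b := by
  constructor
  · intro heq
    have h0 := norm_trace_sq_le hσ b
    have h1 : 0 ≤ ∑ i : Fin k, ‖σ (b i.castSucc) (b i.castSucc)
            - (2 : ℝ) • σ (b (Fin.last k)) (b (Fin.last k))‖ ^ 2 := by positivity
    have h2 : 0 ≤ ∑ i : Fin k, ∑ j ∈ Finset.univ.erase i,
        ‖σ (b i.castSucc) (b j.castSucc)‖ ^ 2 := by positivity
    have h3 : 0 ≤ ∑ i : Fin k, ‖σ (b (Fin.last k)) (b i.castSucc)‖ ^ 2 := by positivity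
    have e1 := (Finset.sum_eq_zero_iff_of_nonneg (fun i _ ↦ by positivity)).1
      (le_antisymm (by linarith) h1)
    have e2 := (Finset.sum_eq_zero_iff_of_nonneg (fun i _ ↦ by positivity)).1
      (le_antisymm (by linarith) h2)
    have e3 := (Finset.sum_eq_zero_iff_of_nonneg (fun i _ ↦ by positivity)).1
      (le_antisymm (by linarith) h3)
    have e3' (i : Fin k) : σ (b (Fin.last k)) (b i.castSucc) = 0 := by
      simpa using e3 i (Finset.mem_univ _)
    refine ⟨fun i j hij ↦ ?_, fun i ↦ ?_⟩
    · induction i using Fin.lastCases with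
      | last =>
        induction j using Fin.lastCases with
        | last => exact absurd rfl hij
        | cast j => exact e3' j
      | cast i =>
        induction j using Fin.lastCases with
        | last => rw [hσ]; exact e3' i
        | cast j =>
          have := (Finset.sum_eq_zero_iff_of_nonneg (fun i _ ↦ by positivity)).1
            (e2 i (Finset.mem_univ _)) j (Finset.mem_erase.2
              ⟨fun h ↦ hij (by rw [h]), Finset.mem_univ _⟩)
          simpa using this
    · simpa [sub_eq_zero] using e1 i (Finset.mem_univ _)
  · rintro ⟨h1, h2⟩
    have e1 : ∑ i : Fin k, ‖σ (b (Fin.last k)) (b i.castSucc)‖ ^ 2 = 0 :=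
      Finset.sum_eq_zero fun i _ ↦ by
        rw [h1 _ _ (Fin.castSucc_lt_last i).ne']
        simp
    have e2 : ∑ i : Fin k, ∑ j ∈ Finset.univ.erase i,
        ‖σ (b i.castSucc) (b j.castSucc)‖ ^ 2 = 0 :=
      Finset.sum_eq_zero fun i _ ↦ Finset.sum_eq_zero fun j hj ↦ by
        rw [h1 _ _ fun h ↦ (Finset.mem_erase.1 hj).1 (Fin.castSucc_injective _ h).symm]
        simp
    rw [sumNormSq_castSucc_add hσ, sumNormSq_eq_diag_add σ (fun i : Fin k ↦ b i.castSucc),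
      Fin.sum_univ_castSucc, e1, e2]
    simp only [h2, norm_smul, Finset.sum_const, Finset.card_univ, Fintype.card_fin]
    have e3 : k • ((2 : ℝ) • σ (b (Fin.last k)) (b (Fin.last k)))
        + σ (b (Fin.last k)) (b (Fin.last k)) =
        (2 * k + 1 : ℝ) • σ (b (Fin.last k)) (b (Fin.last k)) := by
      rw [← Nat.cast_smul_eq_nsmul ℝ]
      module
    rw [e3, norm_smul, mul_pow, Real.norm_eq_abs, sq_abs, nsmul_eq_mul]
    simp
    ring

/-- The squared norm of the restriction of `σ` to a subspace. -/
noncomputable def restrictNormSq (σ : V →ₗ[ℝ] V →ₗ[ℝ] W) (P : Submodule ℝ V)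
    [FiniteDimensional ℝ P] : ℝ :=
  ∑ i, ∑ j, ‖σ (stdOrthonormalBasis ℝ P i : V) (stdOrthonormalBasis ℝ P j)‖ ^ 2

theorem restrictNormSq_eq (σ : V →ₗ[ℝ] V →ₗ[ℝ] W) (P : Submodule ℝ V)
    [FiniteDimensional ℝ P] {ι : Type*} [Fintype ι] (b : OrthonormalBasis ι ℝ P) :
    restrictNormSq σ P = sumNormSq σ (fun i ↦ (b i : V)) :=
  sumNormSq_eq (σ.domRestrict₁₂ P P) (stdOrthonormalBasis ℝ P) b

variable [FiniteDimensional ℝ V]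

theorem restrictNormSq_top (σ : V →ₗ[ℝ] V →ₗ[ℝ] W) {ι : Type*} [Fintype ι]
    (b : OrthonormalBasis ι ℝ V) : restrictNormSq σ ⊤ = sumNormSq σ b := by
  rw [restrictNormSq_eq σ ⊤ (b.map (LinearIsometryEquiv.ofTop V (⊤ : Submodule ℝ V) rfl).symm)]
  rfl

theorem exists_adapted_basis (hV : Module.finrank ℝ V = k + 1) (P : Submodule ℝ V)
    (hP : Module.finrank ℝ P = k) :
    ∃ b : OrthonormalBasis (Fin (k + 1)) ℝ V, ∀ i : Fin k, b i.castSucc ∈ P := by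
  let c : OrthonormalBasis (Fin k) ℝ P := (stdOrthonormalBasis ℝ P).reindex (finCongr hP)
  let v : Fin (k + 1) → V := Fin.snoc (fun i ↦ (c i : V)) 0
  have hv : Orthonormal ℝ (Set.domRestrict (Set.range (Fin.castSucc : Fin k → Fin (k + 1))) v) := by
    have hc : Orthonormal ℝ fun i ↦ (c i : V) := c.orthonormal.comp_linearIsometry P.subtypeₗᵢ
    rw [orthonormal_iff_ite] at hc ⊢
    rintro ⟨_, i, rfl⟩ ⟨_, j, rfl⟩
    have hij := hc i j
    rcases eq_or_ne i j with rfl | hne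
    · simpa [v, Set.domRestrict] using hij
    · have : (Fin.castSucc i) ≠ Fin.castSucc j := fun h ↦ hne (Fin.castSucc_injective _ h)
      rw [if_neg fun h ↦ this (congrArg Subtype.val h)]
      simpa [v, Set.domRestrict, hne] using hij
  obtain ⟨b, hb⟩ := hv.exists_orthonormalBasis_extension_of_card_eq (by simpa using hV)
  refine ⟨b, fun i ↦ ?_⟩
  rw [hb _ ⟨i, rfl⟩]
  simp [v]

theorem exists_basis_last (hV : Module.finrank ℝ V = k + 1) {ξ : V} (hξ : ‖ξ‖ = 1) :
    ∃ b : OrthonormalBasis (Fin (k + 1)) ℝ V, b (Fin.last k) = ξ := by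
  have hv : Orthonormal ℝ (Set.domRestrict {Fin.last k} (fun _ : Fin (k + 1) ↦ ξ)) := by
    rw [orthonormal_iff_ite]
    rintro ⟨_, rfl⟩ ⟨_, rfl⟩
    simp [Set.domRestrict, hξ]
  obtain ⟨b, hb⟩ := hv.exists_orthonormalBasis_extension_of_card_eq (by simpa using hV)
  exact ⟨b, hb _ rfl⟩

theorem restrictNormSq_of_adapted (σ : V →ₗ[ℝ] V →ₗ[ℝ] W)
    (b : OrthonormalBasis (Fin (k + 1)) ℝ V) (P : Submodule ℝ V)
    (hP : Module.finrank ℝ P = k) (hb : ∀ i : Fin k, b i.castSucc ∈ P) :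
    restrictNormSq σ P = sumNormSq σ (fun i : Fin k ↦ b i.castSucc) := by
  let v : Fin k → P := fun i ↦ ⟨b i.castSucc, hb i⟩
  have hv : Orthonormal ℝ v := by
    have := b.orthonormal.comp _ (Fin.castSucc_injective k)
    rw [orthonormal_iff_ite] at this ⊢
    exact this
  have hspan := hv.linearIndependent.span_eq_top_of_card_eq_finrank' (by simp [hP])
  rw [restrictNormSq_eq σ P (OrthonormalBasis.mk hv hspan.ge)]
  simp [v]

omit [FiniteDimensional ℝ V] in
theorem exists_hyperplane (b : OrthonormalBasis (Fin (k + 1)) ℝ V) :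
    ∃ P : Submodule ℝ V, Module.finrank ℝ P = k ∧ ∀ i : Fin k, b i.castSucc ∈ P := by
  refine ⟨Submodule.span ℝ (Set.range fun i : Fin k ↦ b i.castSucc), ?_,
    fun i ↦ Submodule.subset_span ⟨i, rfl⟩⟩
  have := (b.orthonormal.comp _ (Fin.castSucc_injective k)).linearIndependent
  exact (finrank_span_eq_card this).trans (Fintype.card_fin k)

/-- The squared norms of the restrictions of `σ` to hyperplanes attain their supremum. -/
theorem exists_max_restrictNormSq {σ : V →ₗ[ℝ] V →ₗ[ℝ] W} (hσ : ∀ x y, σ x y = σ y x)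
    (hV : Module.finrank ℝ V = k + 1) :
    ∃ P : Submodule ℝ V, Module.finrank ℝ P = k ∧ ∀ Q : Submodule ℝ V, Module.finrank ℝ Q = k →
      restrictNormSq σ Q ≤ restrictNormSq σ P := by
  have e := stdOrthonormalBasis ℝ V
  -- For a unit normal ξ this is the squared norm of σ on the hyperplane orthogonal to ξ. The last
  -- term restores the entry `σ(ξ, ξ)`, removed twice by the middle one. Maximizing over hyperplanes
  -- thus becomes maximizing a continuous function on the compact unit sphere.
  let g (ξ : V) : ℝ := sumNormSq σ e - 2 * ∑ i, ‖σ ξ (e i)‖ ^ 2 + ‖σ ξ ξ‖ ^ 2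
  have hg (b : OrthonormalBasis (Fin (k + 1)) ℝ V) :
      sumNormSq σ (fun i : Fin k ↦ b i.castSucc) = g (b (Fin.last k)) := by
    have h1 := sumNormSq_castSucc_add hσ b
    have h2 := b.sum_norm_sq_eq e (σ (b (Fin.last k)))
    rw [Fin.sum_univ_castSucc] at h2
    simp only [g, sumNormSq_eq σ e b, ← h2]
    linarith
  have hc : Continuous g := by
    have h1 (x : V) : Continuous fun ξ ↦ σ ξ x :=
      (σ.flip x).continuous_of_finiteDimensional
    have h2 : Continuous fun ξ ↦ σ ξ ξ := by
      have : (fun ξ ↦ σ ξ ξ) = fun ξ ↦ ∑ i, ⟪e i, ξ⟫ • σ ξ (e i) := by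
        ext ξ
        conv_lhs => rw [← e.sum_repr' ξ]
        rw [map_sum]
        simp only [map_smul]
        rw [e.sum_repr' ξ]
      rw [this]
      exact continuous_finsetSum _ fun i _ ↦
        (continuous_const.inner continuous_id).smul (h1 (e i))
    exact (continuous_const.sub (continuous_const.mul
      (continuous_finsetSum _ fun i _ ↦ (h1 (e i)).norm.pow 2))).add (h2.norm.pow 2)
  obtain ⟨ξ, hξ, hmax⟩ := (isCompact_sphere (0 : V) 1).exists_isMaxOn
    ⟨e.reindex (finCongr hV) (Fin.last k), by simp⟩ hc.continuousOn
  obtain ⟨b, hb⟩ := exists_basis_last hV (by simpa using hξ)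
  obtain ⟨P, hP, hPb⟩ := exists_hyperplane b
  refine ⟨P, hP, fun Q hQ ↦ ?_⟩
  obtain ⟨b', hb'⟩ := exists_adapted_basis hV Q hQ
  rw [restrictNormSq_of_adapted σ b' Q hQ hb', restrictNormSq_of_adapted σ b P hP hPb, hg, hg, hb]
  exact hmax (by simp)

/-- The algebraic form of the Casorati inequality and of its equality case. -/
theorem casorati_inequality {σ : V →ₗ[ℝ] V →ₗ[ℝ] W} (hσ : ∀ x y, σ x y = σ y x) (hk : 0 < k)
    (hV : Module.finrank ℝ V = k + 1) {ι : Type*} [Fintype ι] (e : OrthonormalBasis ι ℝ V)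
    {c τ D : ℝ} (hτ : 2 * τ = (k + 1) * k * c + ‖∑ i, σ (e i) (e i)‖ ^ 2 - sumNormSq σ e)
    (hD : D = 2 * (1 / (k + 1) * sumNormSq σ e) - (2 * (k + 1) - 1) / (2 * (k + 1)) *
      sSup {x : ℝ | ∃ P : Submodule ℝ V, Module.finrank ℝ P = k ∧
        x = 1 / k * restrictNormSq σ P}) :
    2 * τ / ((k + 1) * k) ≤ D + c ∧ (2 * τ / ((k + 1) * k) = D + c ↔
      ∃ b : OrthonormalBasis (Fin (k + 1)) ℝ V, IsHalfUmbilicalBasis σ b) := by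
  obtain ⟨P, hP, hmax⟩ := exists_max_restrictNormSq hσ hV
  have hk' : (0 : ℝ) < k := by exact_mod_cast hk
  have hsup : sSup {x : ℝ | ∃ P : Submodule ℝ V, Module.finrank ℝ P = k ∧
      x = 1 / k * restrictNormSq σ P} = 1 / k * restrictNormSq σ P := by
    refine IsGreatest.csSup_eq ⟨⟨P, hP, rfl⟩, ?_⟩
    rintro _ ⟨Q, hQ, rfl⟩
    exact mul_le_mul_of_nonneg_left (hmax Q hQ) (by positivity)
  have htr (b : OrthonormalBasis (Fin (k + 1)) ℝ V) :
      ∑ i, σ (e i) (e i) = ∑ i, σ (b i) (b i) := e.sum_bilin_self_eq b σ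
  -- The gap in the stated inequality is a positive multiple of the gap in the trace inequality for
  -- the maximizing hyperplane P.
  have hdiff : D + c - 2 * τ / ((k + 1) * k) = 1 / ((k + 1) * k) *
      ((2 * k + 1) * sumNormSq σ e - (‖∑ i, σ (e i) (e i)‖ ^ 2
        + (2 * k + 1) / 2 * restrictNormSq σ P)) := by
    rw [hD, hsup, hτ]
    field_simp
    ring
  have hpos : (0 : ℝ) < 1 / ((k + 1) * k) := by positivity
  obtain ⟨b, hb⟩ := exists_adapted_basis hV P hP
  have hle := norm_trace_sq_le' hσ b
  have hiff := norm_trace_sq_eq_iff hσ b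
  rw [← sumNormSq_eq σ e b, ← htr b, ← restrictNormSq_of_adapted σ b P hP hb] at hle hiff
  have hle' : 0 ≤ D + c - 2 * τ / ((k + 1) * k) := by
    rw [hdiff]
    exact mul_nonneg hpos.le (sub_nonneg.2 hle)
  refine ⟨by linarith, fun heq ↦ ⟨b, hiff.1 ?_⟩, ?_⟩
  · have h0 : D + c - 2 * τ / ((k + 1) * k) = 0 := by linarith
    rw [hdiff, mul_eq_zero, or_iff_right hpos.ne'] at h0
    linarith
  -- The hyperplane Q of the given basis is not assumed maximal. Equality for Q together with ‖σ|Q‖²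
  -- ≤ ‖σ|P‖² makes the gap for P nonpositive, hence zero.
  · rintro ⟨b', hb'⟩
    obtain ⟨Q, hQ, hQb⟩ := exists_hyperplane b'
    have h1 := (norm_trace_sq_eq_iff hσ b').2 hb'
    rw [← sumNormSq_eq σ e b', ← htr b', ← restrictNormSq_of_adapted σ b' Q hQ hQb] at h1
    have h2 : (2 * k + 1) / 2 * restrictNormSq σ Q ≤ (2 * k + 1) / 2 * restrictNormSq σ P :=
      mul_le_mul_of_nonneg_left (hmax Q hQ) (by positivity)
    have h3 : D + c - 2 * τ / ((k + 1) * k) ≤ 0 := by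
      rw [hdiff]
      exact mul_nonpos_of_nonneg_of_nonpos hpos.le (by linarith)
    linarith

end Casorati

/-! ### The metric of a manifold in its preferred charts -/

section ChartMetric

variable {n : ℕ} {M : Type*} [TopologicalSpace M] [ChartedSpace (EuclideanSpace ℝ (Fin n)) M]
  [IsManifold (𝓡 n) ∞ M]

omit [IsManifold (𝓡 n) ∞ M] in
theorem mfderivWithin_range_extChartAt_symm_eq (p : M) (y : EuclideanSpace ℝ (Fin n)) :
    mfderivWithin 𝓘(ℝ, EuclideanSpace ℝ (Fin n)) (𝓡 n) (extChartAt (𝓡 n) p).symm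
      (Set.range (𝓡 n)) y = mfderiv (𝓡 n) (𝓡 n) (extChartAt (𝓡 n) p).symm y := by
  rw [ModelWithCorners.range_eq_univ, mfderivWithin_univ]

theorem mfderiv_extChartAt_symm_apply {p : M} {y : EuclideanSpace ℝ (Fin n)}
    (hy : y ∈ (extChartAt (𝓡 n) p).target)
    (X : TangentSpace (𝓡 n) ((extChartAt (𝓡 n) p).symm y)) :
    mfderiv (𝓡 n) (𝓡 n) (extChartAt (𝓡 n) p).symm y
      (mfderiv (𝓡 n) (𝓡 n) (extChartAt (𝓡 n) p) ((extChartAt (𝓡 n) p).symm y) X) = X := by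
  have : IsManifold (𝓡 n) 1 M := IsManifold.of_le (n := ∞) (by exact_mod_cast le_top)
  have := mfderivWithin_extChartAt_symm_comp_mfderiv_extChartAt (I := 𝓡 n) hy
  rw [mfderivWithin_range_extChartAt_symm_eq] at this
  exact congrArg (fun l ↦ l X) this

theorem mfderiv_extChartAt_apply_symm {p : M} {y : EuclideanSpace ℝ (Fin n)}
    (hy : y ∈ (extChartAt (𝓡 n) p).target) (u : EuclideanSpace ℝ (Fin n)) :
    mfderiv (𝓡 n) (𝓡 n) (extChartAt (𝓡 n) p) ((extChartAt (𝓡 n) p).symm y)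
      (mfderiv (𝓡 n) (𝓡 n) (extChartAt (𝓡 n) p).symm y u) = u := by
  have : IsManifold (𝓡 n) 1 M := IsManifold.of_le (n := ∞) (by exact_mod_cast le_top)
  have := mfderiv_extChartAt_comp_mfderivWithin_extChartAt_symm (I := 𝓡 n) hy
  rw [mfderivWithin_range_extChartAt_symm_eq] at this
  exact congrArg (fun l ↦ l u) this

theorem contMDiffOn_mfderiv_extChartAt_symm (p : M) (u : EuclideanSpace ℝ (Fin n)) :
    ContMDiffOn (𝓡 n) (𝓡 n).tangent ∞
      (fun y ↦ (⟨(extChartAt (𝓡 n) p).symm y, mfderiv (𝓡 n) (𝓡 n) (extChartAt (𝓡 n) p).symm y u⟩ :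
        TangentBundle (𝓡 n) M)) (extChartAt (𝓡 n) p).target := by
  have : IsManifold (𝓡 n) 1 M := IsManifold.of_le (n := ∞) (by exact_mod_cast le_top)
  have hopen := isOpen_extChartAt_target (I := 𝓡 n) p
  have h1 := (contMDiffOn_extChartAt_symm (I := 𝓡 n) (n := ∞) p).contMDiffOn_tangentMapWithin
    (m := ∞) (by simp) hopen.uniqueMDiffOn
  have h2 : ContMDiffOn (𝓡 n) (𝓡 n).tangent ∞
      (fun y ↦ (⟨y, u⟩ : TangentBundle (𝓡 n) (EuclideanSpace ℝ (Fin n))))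
      (extChartAt (𝓡 n) p).target := by
    intro y _
    exact (contMDiffAt_vectorSpace_iff_contDiffAt.2 contDiffAt_const).contMDiffWithinAt
  refine (h1.comp h2 fun y hy ↦ hy).congr fun y hy ↦ ?_
  simp only [tangentMapWithin, Function.comp]
  rw [mfderivWithin_of_isOpen hopen hy]

variable [Bundle.RiemannianBundle (fun x : M ↦ TangentSpace (𝓡 n) x)]

/-- The base point q is a variable with an equation because going through the chart and back returns
p only propositionally, while the tangent spaces depend on the point. -/
theorem chartMetric_mfderiv {p q : M} {y : EuclideanSpace ℝ (Fin n)}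
    (hy : y ∈ (extChartAt (𝓡 n) p).target) (hq : (extChartAt (𝓡 n) p).symm y = q)
    (X Y : TangentSpace (𝓡 n) q) :
    chartMetric p y (mfderiv (𝓡 n) (𝓡 n) (extChartAt (𝓡 n) p) q X)
      (mfderiv (𝓡 n) (𝓡 n) (extChartAt (𝓡 n) p) q Y) = ⟪X, Y⟫ := by
  subst hq
  refine (chartMetric_apply p y _ _).trans ?_
  rw [mfderiv_extChartAt_symm_apply hy, mfderiv_extChartAt_symm_apply hy]

omit [IsManifold (𝓡 n) ∞ M] [Bundle.RiemannianBundle (fun x : M ↦ TangentSpace (𝓡 n) x)] in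
theorem chartVector_add (p : M) (X Y : TangentSpace (𝓡 n) p) :
    chartVector p (X + Y) = chartVector p X + chartVector p Y := map_add _ X Y

omit [IsManifold (𝓡 n) ∞ M] [Bundle.RiemannianBundle (fun x : M ↦ TangentSpace (𝓡 n) x)] in
theorem chartVector_smul (p : M) (a : ℝ) (X : TangentSpace (𝓡 n) p) :
    chartVector p (a • X) = a • chartVector p X := map_smul _ a X

theorem chartMetric_chartVector (p : M) (X Y : TangentSpace (𝓡 n) p) :
    chartMetric p (extChartAt (𝓡 n) p p) (chartVector p X) (chartVector p Y) = ⟪X, Y⟫ :=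
  chartMetric_mfderiv (mem_extChartAt_target p) (extChartAt_to_inv p) X Y

variable [IsContMDiffRiemannianBundle (𝓡 n) ∞ (EuclideanSpace ℝ (Fin n))
      (fun x : M ↦ TangentSpace (𝓡 n) x)]

/-- Smoothness holds because the coordinate fields are smooth sections of the tangent bundle and the
bundle metric is smooth; positivity because the chart derivative is injective. -/
theorem isMetricOn_chartMetric (p : M) :
    LocalGeometry.IsMetricOn (chartMetric p) (extChartAt (𝓡 n) p).target where
  isOpen := isOpen_extChartAt_target p
  contDiffOn := by
    rw [contDiffOn_clm_apply]
    intro u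
    rw [contDiffOn_clm_apply]
    intro v
    exact ((contMDiffOn_mfderiv_extChartAt_symm p u).inner_bundle
      (contMDiffOn_mfderiv_extChartAt_symm p v)).contDiffOn
  symm y _ u v := by
    rw [chartMetric_apply, chartMetric_apply, real_inner_comm]
  pos y hy u hu := by
    rw [chartMetric_apply, real_inner_self_eq_norm_sq]
    have : mfderiv (𝓡 n) (𝓡 n) (extChartAt (𝓡 n) p).symm y u ≠ 0 := by
      intro h0
      apply hu
      rw [← mfderiv_extChartAt_apply_symm hy u, h0, map_zero]
      rfl
    have := norm_pos_iff.2 this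
    positivity

theorem isCurvatureLike_riemannTensor (p : M) : IsCurvatureLike (riemannTensor (n := n) p) := by
  have h := isMetricOn_chartMetric (n := n) p
  have hy := mem_extChartAt_target (I := 𝓡 n) p
  constructor
  · intro x x' y z w
    simp only [riemannTensor, h.curvature_eq hy, chartVector_add, map_add, map_sub, _root_.add_apply,
      _root_.sub_apply]
    ring
  · intro a x y z w
    simp only [riemannTensor, h.curvature_eq hy, chartVector_smul, map_smul, map_add, map_sub,
      _root_.add_apply, _root_.sub_apply, _root_.smul_apply, smul_eq_mul]
    ring
  · intro x y z w
    simp only [riemannTensor, h.curvature_eq hy, map_add, map_sub, _root_.add_apply,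
      _root_.sub_apply]
    ring
  · intro x y z w
    exact h.metric_curvature_antisymm hy _ _ _ _
  · intro x y z w
    simp only [riemannTensor]
    rw [← _root_.add_apply, ← _root_.add_apply, ← map_add, ← map_add, h.curvature_bianchi hy]
    simp

theorem riemannTensor_eq_of_constant {c : ℝ} (hc : HasConstantSectionalCurvature n M c) (p : M)
    (X Y Z W : TangentSpace (𝓡 n) p) :
    riemannTensor p X Y Z W = c * (⟪Y, Z⟫ * ⟪X, W⟫ - ⟪X, Z⟫ * ⟪Y, W⟫) :=
  (isCurvatureLike_riemannTensor p).eq_of_sectional_eq (hc p) X Y Z W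

end ChartMetric

/-! ### The immersion in charts and its second fundamental form -/

section Immersion

variable {n m : ℕ}
  {M : Type*} [TopologicalSpace M] [ChartedSpace (EuclideanSpace ℝ (Fin n)) M]
  [IsManifold (𝓡 n) ∞ M]
  [Bundle.RiemannianBundle (fun x : M ↦ TangentSpace (𝓡 n) x)]
  [IsContMDiffRiemannianBundle (𝓡 n) ∞ (EuclideanSpace ℝ (Fin n))
      (fun x : M ↦ TangentSpace (𝓡 n) x)]
  {M' : Type*} [TopologicalSpace M'] [ChartedSpace (EuclideanSpace ℝ (Fin m)) M']
  [IsManifold (𝓡 m) ∞ M']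
  [Bundle.RiemannianBundle (fun x : M' ↦ TangentSpace (𝓡 m) x)]
  [IsContMDiffRiemannianBundle (𝓡 m) ∞ (EuclideanSpace ℝ (Fin m))
      (fun x : M' ↦ TangentSpace (𝓡 m) x)]

/-- The coordinates at which `chartMap f p` is the expression of `f` in the charts. -/
def chartMapDomain (n m : ℕ) {M M' : Type*} [TopologicalSpace M]
    [ChartedSpace (EuclideanSpace ℝ (Fin n)) M] [TopologicalSpace M']
    [ChartedSpace (EuclideanSpace ℝ (Fin m)) M'] (f : M → M') (p : M) :
    Set (EuclideanSpace ℝ (Fin n)) :=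
  (extChartAt (𝓡 n) p).target ∩ (extChartAt (𝓡 n) p).symm ⁻¹'
    (f ⁻¹' (extChartAt (𝓡 m) (f p)).source)

theorem chartMap_self (f : M → M') (p : M) :
    chartMap (n := n) (m := m) f p (extChartAt (𝓡 n) p p) = extChartAt (𝓡 m) (f p) (f p) := by
  rw [chartMap, extChartAt_to_inv]

theorem mem_chartMapDomain (f : M → M') (p : M) :
    extChartAt (𝓡 n) p p ∈ chartMapDomain n m f p := by
  refine ⟨mem_extChartAt_target p, ?_⟩
  simp only [Set.mem_preimage, extChartAt_to_inv]
  exact mem_extChartAt_source (f p)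

variable {f : M → M'} (hf : IsRiemannianSubmanifold n m f)
include hf

namespace IsRiemannianSubmanifold

theorem isOpen_chartMapDomain (p : M) : IsOpen (chartMapDomain n m f p) :=
  (continuousOn_extChartAt_symm p).isOpen_inter_preimage (isOpen_extChartAt_target p)
    ((isOpen_extChartAt_source (f p)).preimage hf.smooth.continuous)

theorem contDiffOn_chartMap (p : M) :
    ContDiffOn ℝ ∞ (chartMap (n := n) (m := m) f p) (chartMapDomain n m f p) := by
  rw [← contMDiffOn_iff_contDiffOn]
  exact ((contMDiffOn_extChartAt (I := 𝓡 m) (n := ∞) (x := f p)).comp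
    (hf.smooth.comp_contMDiffOn ((contMDiffOn_extChartAt_symm (I := 𝓡 n) (n := ∞) p).mono
      Set.inter_subset_left)) fun y hy ↦ by
        simpa [chartMapDomain] using hy.2)

theorem fderiv_chartMap {p : M} {y : EuclideanSpace ℝ (Fin n)} (hy : y ∈ chartMapDomain n m f p)
    (u : EuclideanSpace ℝ (Fin n)) :
    fderiv ℝ (chartMap (n := n) (m := m) f p) y u =
      mfderiv (𝓡 m) (𝓡 m) (extChartAt (𝓡 m) (f p)) (f ((extChartAt (𝓡 n) p).symm y))
        (mfderiv (𝓡 n) (𝓡 m) f ((extChartAt (𝓡 n) p).symm y)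
          (mfderiv (𝓡 n) (𝓡 n) (extChartAt (𝓡 n) p).symm y u)) := by
  have h1 : MDifferentiableAt (𝓡 n) (𝓡 n) (extChartAt (𝓡 n) p).symm y :=
    ((contMDiffOn_extChartAt_symm (I := 𝓡 n) (n := ∞) p).contMDiffAt
      ((isOpen_extChartAt_target p).mem_nhds hy.1)).mdifferentiableAt (by simp)
  have h2 : MDifferentiableAt (𝓡 n) (𝓡 m) f ((extChartAt (𝓡 n) p).symm y) :=
    hf.smooth.mdifferentiableAt (by simp)
  have h3 : MDifferentiableAt (𝓡 m) (𝓡 m) (extChartAt (𝓡 m) (f p))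
      (f ((extChartAt (𝓡 n) p).symm y)) :=
    (contMDiffAt_extChartAt' (n := ∞) (by simpa [chartMapDomain] using hy.2)).mdifferentiableAt
      (by simp)
  have e : chartMap (n := n) (m := m) f p =
      extChartAt (𝓡 m) (f p) ∘ (f ∘ (extChartAt (𝓡 n) p).symm) := rfl
  rw [← mfderiv_eq_fderiv, e, mfderiv_comp y h3 (h2.comp y h1), mfderiv_comp y h2 h1]
  rfl

theorem fderiv_chartMap_mfderiv {p q : M} {y : EuclideanSpace ℝ (Fin n)}
    (hy : y ∈ chartMapDomain n m f p) (hq : (extChartAt (𝓡 n) p).symm y = q)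
    (X : TangentSpace (𝓡 n) q) :
    fderiv ℝ (chartMap (n := n) (m := m) f p) y (mfderiv (𝓡 n) (𝓡 n) (extChartAt (𝓡 n) p) q X) =
      mfderiv (𝓡 m) (𝓡 m) (extChartAt (𝓡 m) (f p)) (f q) (mfderiv (𝓡 n) (𝓡 m) f q X) := by
  subst hq
  refine (hf.fderiv_chartMap hy _).trans ?_
  rw [mfderiv_extChartAt_symm_apply hy.1]

theorem fderiv_chartMap_chartVector (p : M) (X : TangentSpace (𝓡 n) p) :
    fderiv ℝ (chartMap (n := n) (m := m) f p) (extChartAt (𝓡 n) p p) (chartVector p X) =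
      chartVector (f p) (mfderiv (𝓡 n) (𝓡 m) f p X) :=
  hf.fderiv_chartMap_mfderiv (mem_chartMapDomain f p) (extChartAt_to_inv p) X

theorem chartMetric_fderiv_chartMap {p : M} {y : EuclideanSpace ℝ (Fin n)}
    (hy : y ∈ chartMapDomain n m f p) (u v : EuclideanSpace ℝ (Fin n)) :
    chartMetric (f p) (chartMap (m := m) f p y) (fderiv ℝ (chartMap (m := m) f p) y u)
      (fderiv ℝ (chartMap (m := m) f p) y v) = chartMetric p y u v := by
  rw [hf.fderiv_chartMap hy, hf.fderiv_chartMap hy]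
  exact ((chartMetric_mfderiv ((extChartAt (𝓡 m) (f p)).map_source hy.2)
    ((extChartAt (𝓡 m) (f p)).left_inv hy.2) _ _).trans (hf.isometric _ _ _)).trans
      (chartMetric_apply p y u v).symm

theorem isMetricOn_chartMapDomain (p : M) :
    LocalGeometry.IsMetricOn (chartMetric p) (chartMapDomain n m f p) where
  isOpen := hf.isOpen_chartMapDomain p
  contDiffOn := (isMetricOn_chartMetric p).contDiffOn.mono Set.inter_subset_left
  symm _ hy := (isMetricOn_chartMetric p).symm _ hy.1
  pos _ hy := (isMetricOn_chartMetric p).pos _ hy.1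

theorem isIsometricOn (p : M) : LocalGeometry.IsIsometricOn (chartMetric p) (chartMetric (f p))
    (chartMap f p) (chartMapDomain n m f p) (extChartAt (𝓡 m) (f p)).target where
  dom := hf.isMetricOn_chartMapDomain p
  cod := isMetricOn_chartMetric (f p)
  contDiffOn := hf.contDiffOn_chartMap p
  mapsTo _ hy := (extChartAt (𝓡 m) (f p)).map_source hy.2
  induced_eq _ hy := ContinuousLinearMap.ext fun u ↦ ContinuousLinearMap.ext fun v ↦
    hf.chartMetric_fderiv_chartMap hy u v

/-- The `inverse` in the definition is a true inverse, the derivative of a chart being invertible.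
Local identities for the second fundamental form pass to the manifold through this. -/
theorem chartVector_secondFundamentalForm (p : M) (X Y : TangentSpace (𝓡 n) p) :
    chartVector (f p) (secondFundamentalForm (m := m) f p X Y) =
      LocalGeometry.secondFundamentalForm (chartMetric (f p)) (chartMap f p)
        (extChartAt (𝓡 n) p p) (chartVector p X) (chartVector p Y) := by
  have : IsManifold (𝓡 m) 1 M' := IsManifold.of_le (n := ∞) (by exact_mod_cast le_top)
  exact (isInvertible_mfderiv_extChartAt (I := 𝓡 m)
    (mem_extChartAt_source (f p))).self_apply_inverse _

omit hf in
theorem chartVector_injective {q : M} : Function.Injective (chartVector (n := n) q) := by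
  have : IsManifold (𝓡 n) 1 M := IsManifold.of_le (n := ∞) (by exact_mod_cast le_top)
  exact (isInvertible_mfderiv_extChartAt (I := 𝓡 n) (mem_extChartAt_source q)).injective

omit hf in
theorem chartVector_surjective {q : M} : Function.Surjective (chartVector (n := n) q) := by
  have : IsManifold (𝓡 n) 1 M := IsManifold.of_le (n := ∞) (by exact_mod_cast le_top)
  exact (isInvertible_mfderiv_extChartAt (I := 𝓡 n) (mem_extChartAt_source q)).surjective

theorem secondFundamentalForm_symm (p : M) (X Y : TangentSpace (𝓡 n) p) :
    secondFundamentalForm f p X Y = secondFundamentalForm (m := m) f p Y X := by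
  apply chartVector_injective
  rw [hf.chartVector_secondFundamentalForm, hf.chartVector_secondFundamentalForm,
    (hf.isIsometricOn p).secondFundamentalForm_symm (mem_chartMapDomain f p)]

theorem secondFundamentalForm_add (p : M) (X Y Z : TangentSpace (𝓡 n) p) :
    secondFundamentalForm f p X (Y + Z) =
      secondFundamentalForm (m := m) f p X Y + secondFundamentalForm f p X Z := by
  apply chartVector_injective
  rw [chartVector_add]
  simp only [hf.chartVector_secondFundamentalForm]
  rw [chartVector_add, (hf.isIsometricOn p).secondFundamentalForm_add (mem_chartMapDomain f p)]

theorem secondFundamentalForm_smul (p : M) (X Y : TangentSpace (𝓡 n) p) (a : ℝ) :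
    secondFundamentalForm f p X (a • Y) = a • secondFundamentalForm (m := m) f p X Y := by
  apply chartVector_injective
  rw [chartVector_smul]
  simp only [hf.chartVector_secondFundamentalForm]
  rw [chartVector_smul, (hf.isIsometricOn p).secondFundamentalForm_smul (mem_chartMapDomain f p)]

/-- The second fundamental form as a bilinear map. -/
noncomputable def sff (p : M) :
    TangentSpace (𝓡 n) p →ₗ[ℝ] TangentSpace (𝓡 n) p →ₗ[ℝ] TangentSpace (𝓡 m) (f p) :=
  LinearMap.mk₂ ℝ (secondFundamentalForm f p)
    (fun X Y Z ↦ by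
      rw [hf.secondFundamentalForm_symm, hf.secondFundamentalForm_add,
        hf.secondFundamentalForm_symm p Z X, hf.secondFundamentalForm_symm p Z Y])
    (fun a X Y ↦ by
      rw [hf.secondFundamentalForm_symm, hf.secondFundamentalForm_smul,
        hf.secondFundamentalForm_symm])
    (fun X Y Z ↦ hf.secondFundamentalForm_add p X Y Z)
    (fun a X Y ↦ hf.secondFundamentalForm_smul p X Y a)

theorem sff_apply (p : M) (X Y : TangentSpace (𝓡 n) p) :
    hf.sff p X Y = secondFundamentalForm f p X Y := rfl

theorem sff_symm (p : M) (X Y : TangentSpace (𝓡 n) p) : hf.sff p X Y = hf.sff p Y X :=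
  hf.secondFundamentalForm_symm p X Y

theorem inner_chartVector (p : M) (X Y : TangentSpace (𝓡 m) (f p)) :
    chartMetric (f p) (chartMap (n := n) f p (extChartAt (𝓡 n) p p)) (chartVector (f p) X)
      (chartVector (f p) Y) = ⟪X, Y⟫ := by
  rw [chartMap_self, chartMetric_chartVector]

theorem inner_sff_mfderiv (p : M) (X Y Z : TangentSpace (𝓡 n) p) :
    ⟪hf.sff p X Y, mfderiv (𝓡 n) (𝓡 m) f p Z⟫ = 0 := by
  rw [← hf.inner_chartVector p, hf.sff_apply, hf.chartVector_secondFundamentalForm,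
    ← hf.fderiv_chartMap_chartVector,
    (hf.isIsometricOn p).metric_secondFundamentalForm (mem_chartMapDomain f p)]

/-- The Gauss equation. -/
theorem riemannTensor_eq (p : M) (X Y Z W : TangentSpace (𝓡 n) p) :
    riemannTensor p X Y Z W =
      riemannTensor (f p) (mfderiv (𝓡 n) (𝓡 m) f p X) (mfderiv (𝓡 n) (𝓡 m) f p Y)
        (mfderiv (𝓡 n) (𝓡 m) f p Z) (mfderiv (𝓡 n) (𝓡 m) f p W)
      + ⟪hf.sff p Y Z, hf.sff p X W⟫ - ⟪hf.sff p X Z, hf.sff p Y W⟫ := by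
  have h := (hf.isIsometricOn p).gauss_equation (mem_chartMapDomain f p) (chartVector p X)
    (chartVector p Y) (chartVector p Z) (chartVector p W)
  simp only [hf.fderiv_chartMap_chartVector, ← hf.chartVector_secondFundamentalForm,
    hf.inner_chartVector] at h
  rw [chartMap_self] at h
  exact h

end IsRiemannianSubmanifold

end Immersion

/-! ### Orthonormal frames and sums over bases -/

section Frames

variable {F : Type*} [NormedAddCommGroup F] [InnerProductSpace ℝ F]

/-- Normalize g and complete it to a basis starting at index 0. A nonzero g forces d > 0; for g = 0
any basis will do. -/
theorem exists_orthonormal_frame_aligned {d : ℕ} (P : Submodule ℝ F) [FiniteDimensional ℝ P]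
    (hP : Module.finrank ℝ P = d) {g : F} (hg : g ∈ P) :
    ∃ ν : Fin d → F, Orthonormal ℝ ν ∧ (∀ α, ν α ∈ P) ∧ ∀ α : Fin d, (α : ℕ) ≠ 0 → ⟪g, ν α⟫ = 0 := by
  have key : ∃ b : OrthonormalBasis (Fin d) ℝ P, ∀ α : Fin d, (α : ℕ) ≠ 0 → ⟪g, (b α : F)⟫ = 0 := by
    rcases eq_or_ne g 0 with rfl | hg0
    · exact ⟨(stdOrthonormalBasis ℝ P).reindex (finCongr hP), fun _ _ ↦ inner_zero_left _⟩
    have hx : (⟨g, hg⟩ : P) ≠ 0 := fun h ↦ hg0 (congrArg Subtype.val h)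
    have hd : 0 < d := hP ▸ Module.finrank_pos_iff_exists_ne_zero.2 ⟨_, hx⟩
    let u : P := (‖(⟨g, hg⟩ : P)‖⁻¹ : ℝ) • ⟨g, hg⟩
    have hu : ‖u‖ = 1 := by
      rw [norm_smul, norm_inv, norm_norm, inv_mul_cancel₀ (norm_ne_zero_iff.2 hx)]
    have hv : Orthonormal ℝ (Set.domRestrict {(⟨0, hd⟩ : Fin d)} (fun _ ↦ u)) := by
      rw [orthonormal_iff_ite]
      rintro ⟨_, rfl⟩ ⟨_, rfl⟩
      simp [Set.domRestrict, hu]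
    obtain ⟨b, hb⟩ := hv.exists_orthonormalBasis_extension_of_card_eq (by simpa using hP)
    refine ⟨b, fun α hα ↦ ?_⟩
    have h0 : b ⟨0, hd⟩ = u := hb _ rfl
    have h1 : ⟪u, b α⟫ = 0 := by
      rw [← h0]
      exact b.orthonormal.2 fun h ↦ hα (by rw [← h])
    have h2 : ‖(⟨g, hg⟩ : P)‖ ≠ 0 := norm_ne_zero_iff.2 hx
    rw [inner_smul_left] at h1
    simpa [hg0] using h1
  obtain ⟨b, hb⟩ := key
  exact ⟨fun α ↦ b α, b.orthonormal.comp_linearIsometry P.subtypeₗᵢ, fun α ↦ (b α).2, hb⟩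

theorem eq_zero_of_inner_orthonormal_eq_zero {d : ℕ} (P : Submodule ℝ F) [FiniteDimensional ℝ P]
    (hP : Module.finrank ℝ P = d) {ν : Fin d → F} (hν : Orthonormal ℝ ν) (hνP : ∀ α, ν α ∈ P)
    {w : F} (hw : w ∈ P) (h0 : ∀ α, ⟪w, ν α⟫ = 0) : w = 0 := by
  let v : Fin d → P := fun α ↦ ⟨ν α, hνP α⟩
  have hv : Orthonormal ℝ v := by
    rw [orthonormal_iff_ite] at hν ⊢
    exact hν
  have hspan := hv.linearIndependent.span_eq_top_of_card_eq_finrank' (by simp [hP])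
  let b := OrthonormalBasis.mk hv hspan.ge
  have : (⟨w, hw⟩ : P) = 0 := by
    rw [← b.sum_repr' ⟨w, hw⟩]
    refine Finset.sum_eq_zero fun α _ ↦ ?_
    have : ⟪b α, (⟨w, hw⟩ : P)⟫ = 0 := by
      rw [real_inner_comm]
      simpa [b, v] using h0 α
    rw [this, zero_smul]
  exact congrArg Subtype.val this

theorem two_mul_sum_lt {N : ℕ} {K : Fin N → Fin N → ℝ} (hK : ∀ i j, K i j = K j i) :
    2 * ∑ i, ∑ j with i < j, K i j = ∑ i, ∑ j, K i j - ∑ i, K i i := by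
  have h1 : ∑ i, ∑ j with i < j, K i j = ∑ i, ∑ j, if i < j then K i j else 0 :=
    Finset.sum_congr rfl fun i _ ↦ Finset.sum_filter _ _
  have h2 : ∑ i, ∑ j with i < j, K i j = ∑ i, ∑ j, if j < i then K i j else 0 := by
    rw [h1, Finset.sum_comm]
    exact Finset.sum_congr rfl fun i _ ↦ Finset.sum_congr rfl fun j _ ↦ by rw [hK]
  have h3 : ∑ i, K i i = ∑ i, ∑ j, if i = j then K i j else 0 := by simp
  rw [two_mul]
  nth_rewrite 1 [h1]
  rw [h2, h3, eq_sub_iff_add_eq]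
  simp only [← Finset.sum_add_distrib]
  refine Finset.sum_congr rfl fun i _ ↦ Finset.sum_congr rfl fun j _ ↦ ?_
  rcases lt_trichotomy i j with h | h | h
  · simp [h, h.not_gt, h.ne]
  · simp [h]
  · simp [h, h.not_gt, h.ne']

theorem bilin_apply_of_diagonal {V W ι : Type*} [NormedAddCommGroup V] [InnerProductSpace ℝ V]
    [AddCommGroup W] [Module ℝ W] [Fintype ι] (σ : V →ₗ[ℝ] V →ₗ[ℝ] W)
    (b : OrthonormalBasis ι ℝ V) (h : ∀ i j, i ≠ j → σ (b i) (b j) = 0) (x y : V) :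
    σ x y = ∑ i, (⟪b i, x⟫ * ⟪b i, y⟫) • σ (b i) (b i) := by
  conv_lhs => rw [← b.sum_repr' x, ← b.sum_repr' y]
  simp only [map_sum, LinearMap.sum_apply, map_smul, LinearMap.smul_apply]
  refine Finset.sum_congr rfl fun i _ ↦ ?_
  rw [Finset.sum_eq_single i (fun j _ hj ↦ by rw [h j i hj, smul_zero]) (by simp), smul_smul,
    mul_comm]

/-- Normal fields are smooth and normal only near the point, so the Ricci equation is applied on a
smaller neighbourhood. -/
theorem LocalGeometry.IsIsometricOn.mono {E E' : Type*} [NormedAddCommGroup E] [NormedSpace ℝ E]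
    [NormedAddCommGroup E'] [NormedSpace ℝ E'] {G : E → E →L[ℝ] E →L[ℝ] ℝ}
    {G' : E' → E' →L[ℝ] E' →L[ℝ] ℝ} {f : E → E'} {s t : Set E} {s' : Set E'}
    (h : IsIsometricOn G G' f s s') (ht : IsOpen t) (hts : t ⊆ s) : IsIsometricOn G G' f t s' where
  dom := ⟨ht, h.dom.contDiffOn.mono hts, fun y hy ↦ h.dom.symm y (hts hy),
    fun y hy ↦ h.dom.pos y (hts hy)⟩
  cod := h.cod
  contDiffOn := h.contDiffOn.mono hts
  mapsTo := h.mapsTo.mono_left hts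
  induced_eq y hy := h.induced_eq y (hts hy)

end Frames

/-! ### Normal space, shape operators and scalar curvature -/

namespace IsRiemannianSubmanifold

variable {n m : ℕ}
  {M : Type*} [TopologicalSpace M] [ChartedSpace (EuclideanSpace ℝ (Fin n)) M]
  [IsManifold (𝓡 n) ∞ M]
  [Bundle.RiemannianBundle (fun x : M ↦ TangentSpace (𝓡 n) x)]
  [IsContMDiffRiemannianBundle (𝓡 n) ∞ (EuclideanSpace ℝ (Fin n))
      (fun x : M ↦ TangentSpace (𝓡 n) x)]
  {M' : Type*} [TopologicalSpace M'] [ChartedSpace (EuclideanSpace ℝ (Fin m)) M']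
  [IsManifold (𝓡 m) ∞ M']
  [Bundle.RiemannianBundle (fun x : M' ↦ TangentSpace (𝓡 m) x)]
  [IsContMDiffRiemannianBundle (𝓡 m) ∞ (EuclideanSpace ℝ (Fin m))
      (fun x : M' ↦ TangentSpace (𝓡 m) x)]
  {f : M → M'} (hf : IsRiemannianSubmanifold n m f)
include hf

/-- The normal space of the immersion. -/
noncomputable def normalSpace (n : ℕ) {m : ℕ}
    {M : Type*} [TopologicalSpace M] [ChartedSpace (EuclideanSpace ℝ (Fin n)) M]
    {M' : Type*} [TopologicalSpace M'] [ChartedSpace (EuclideanSpace ℝ (Fin m)) M']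
    [Bundle.RiemannianBundle (fun x : M' ↦ TangentSpace (𝓡 m) x)] (f : M → M') (p : M) :
    Submodule ℝ (TangentSpace (𝓡 m) (f p)) :=
  (LinearMap.range (mfderiv (𝓡 n) (𝓡 m) f p).toLinearMap)ᗮ

omit hf in
theorem mem_normalSpace {p : M} {w : TangentSpace (𝓡 m) (f p)} :
    w ∈ normalSpace n f p ↔ ∀ X : TangentSpace (𝓡 n) p, ⟪w, mfderiv (𝓡 n) (𝓡 m) f p X⟫ = 0 := by
  rw [normalSpace, Submodule.mem_orthogonal']
  constructor
  · intro h X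
    exact h _ ⟨X, rfl⟩
  · rintro h _ ⟨X, rfl⟩
    exact h X

/-- An isometric differential is injective, so n ≤ m and the truncated subtraction is the true
codimension. -/
theorem finrank_normalSpace (p : M) : Module.finrank ℝ (normalSpace (m := m) n f p) = m - n := by
  have hinj : Function.Injective (mfderiv (𝓡 n) (𝓡 m) f p).toLinearMap := by
    rw [injective_iff_map_eq_zero]
    intro X hX
    have := hf.isometric p X X
    rw [show mfderiv (𝓡 n) (𝓡 m) f p X = 0 from hX, inner_zero_left] at this
    exact inner_self_eq_zero.1 this.symm
  have h1 := Submodule.finrank_add_finrank_orthogonal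
    (LinearMap.range (mfderiv (𝓡 n) (𝓡 m) f p).toLinearMap)
  rw [LinearMap.finrank_range_of_inj hinj] at h1
  have h2 : Module.finrank ℝ (TangentSpace (𝓡 n) p) = n := finrank_euclideanSpace_fin
  have h3 : Module.finrank ℝ (TangentSpace (𝓡 m) (f p)) = m := finrank_euclideanSpace_fin
  rw [normalSpace]
  omega

theorem sff_mem_normalSpace (p : M) (X Y : TangentSpace (𝓡 n) p) :
    hf.sff p X Y ∈ normalSpace n f p :=
  mem_normalSpace.2 (hf.inner_sff_mfderiv p X Y)

theorem inner_shapeOperator (p : M) (N : TangentSpace (𝓡 m) (f p)) (X Y : TangentSpace (𝓡 n) p) :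
    ⟪Y, shapeOperator f p N X⟫ = ⟪hf.sff p X Y, N⟫ := by
  set e := stdOrthonormalBasis ℝ (TangentSpace (𝓡 n) p)
  have h : shapeOperator f p N X = ∑ i, ⟪hf.sff p X (e i), N⟫ • e i := rfl
  rw [h]
  conv_rhs => rw [← e.sum_repr' Y]
  simp only [inner_sum, inner_smul_right, map_sum, map_smul, sum_inner, inner_smul_left]
  refine Finset.sum_congr rfl fun i _ ↦ ?_
  rw [real_inner_comm Y]
  simp [mul_comm]

theorem shapeMatrix_apply (p : M) (e : Fin n → TangentSpace (𝓡 n) p)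
    (N : TangentSpace (𝓡 m) (f p)) (i j : Fin n) :
    shapeMatrix f p e N i j = ⟪hf.sff p (e j) (e i), N⟫ :=
  hf.inner_shapeOperator p N (e j) (e i)

/-- The Gauss equation summed over all ordered pairs of basis vectors. -/
theorem two_mul_scalarCurvature {c : ℝ} (hc : HasConstantSectionalCurvature m M' c) (p : M) :
    2 * scalarCurvature n p = (n : ℝ) * (n - 1) * c
      + ‖∑ i, hf.sff p (stdOrthonormalBasis ℝ (TangentSpace (𝓡 n) p) i)
          (stdOrthonormalBasis ℝ (TangentSpace (𝓡 n) p) i)‖ ^ 2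
      - sumNormSq (hf.sff p) (stdOrthonormalBasis ℝ (TangentSpace (𝓡 n) p)) := by
  set e := stdOrthonormalBasis ℝ (TangentSpace (𝓡 n) p)
  have hn : (Module.finrank ℝ (TangentSpace (𝓡 n) p) : ℝ) = n := by
    exact_mod_cast (finrank_euclideanSpace_fin : Module.finrank ℝ (EuclideanSpace ℝ (Fin n)) = n)
  have hunit (i) : ‖mfderiv (𝓡 n) (𝓡 m) f p (e i)‖ = 1 := by
    rw [← sq_eq_sq₀ (norm_nonneg _) zero_le_one, ← real_inner_self_eq_norm_sq, hf.isometric,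
      real_inner_self_eq_norm_sq, e.norm_eq_one]
  -- Extended to i = j, where the σ-terms cancel and K i i = c. Completing the sum thus adds n · c,
  -- which turns n² into n(n - 1).
  let K (i j : Fin (Module.finrank ℝ (TangentSpace (𝓡 n) p))) : ℝ :=
    c + ⟪hf.sff p (e i) (e i), hf.sff p (e j) (e j)⟫ - ‖hf.sff p (e i) (e j)‖ ^ 2
  have hsec (i j) (hij : i < j) : sectionalCurvature p (e i) (e j) = K i j := by
    have h1 : riemannTensor (f p) (mfderiv (𝓡 n) (𝓡 m) f p (e i)) (mfderiv (𝓡 n) (𝓡 m) f p (e j))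
        (mfderiv (𝓡 n) (𝓡 m) f p (e j)) (mfderiv (𝓡 n) (𝓡 m) f p (e i)) = c :=
      hc (f p) _ _ (hunit i) (hunit j)
        ((hf.isometric p (e i) (e j)).trans (e.orthonormal.2 hij.ne))
    rw [sectionalCurvature, hf.riemannTensor_eq, h1, hf.sff_symm p (e j) (e i),
      real_inner_self_eq_norm_sq, real_inner_comm]
  have hs : scalarCurvature n p = ∑ i, ∑ j with i < j, K i j :=
    Finset.sum_congr rfl fun i _ ↦ Finset.sum_congr rfl fun j hj ↦
      hsec i j (Finset.mem_filter.1 hj).2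
  have hK (i j) : K i j = K j i := by
    simp only [K]
    rw [real_inner_comm, hf.sff_symm p (e i) (e j)]
  rw [hs, two_mul_sum_lt hK]
  have h1 : ∑ i, ∑ j, K i j = (n : ℝ) * n * c + ‖∑ i, hf.sff p (e i) (e i)‖ ^ 2
      - sumNormSq (hf.sff p) e := by
    simp only [K, Finset.sum_sub_distrib, Finset.sum_add_distrib, Finset.sum_const,
      Finset.card_univ, Fintype.card_fin, nsmul_eq_mul, hn, sumNormSq, ← inner_sum, ← sum_inner,
      real_inner_self_eq_norm_sq]
    ring
  have h2 : ∑ i, K i i = n * c := by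
    simp [K, hn]
  rw [h1, h2]
  ring

end IsRiemannianSubmanifold

namespace IsRiemannianSubmanifold

/-! ### Flatness of the normal connection -/

section NormalConnection

variable {n m : ℕ}
  {M : Type*} [TopologicalSpace M] [ChartedSpace (EuclideanSpace ℝ (Fin n)) M]
  [IsManifold (𝓡 n) ∞ M]
  [Bundle.RiemannianBundle (fun x : M ↦ TangentSpace (𝓡 n) x)]
  [IsContMDiffRiemannianBundle (𝓡 n) ∞ (EuclideanSpace ℝ (Fin n))
      (fun x : M ↦ TangentSpace (𝓡 n) x)]
  {M' : Type*} [TopologicalSpace M'] [ChartedSpace (EuclideanSpace ℝ (Fin m)) M']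
  [IsManifold (𝓡 m) ∞ M']
  [Bundle.RiemannianBundle (fun x : M' ↦ TangentSpace (𝓡 m) x)]
  [IsContMDiffRiemannianBundle (𝓡 m) ∞ (EuclideanSpace ℝ (Fin m))
      (fun x : M' ↦ TangentSpace (𝓡 m) x)]
  {f : M → M'} (hf : IsRiemannianSubmanifold n m f)
include hf

theorem exists_isNormalFrame_aligned (p : M) {g : TangentSpace (𝓡 m) (f p)}
    (hg : g ∈ normalSpace n f p) :
    ∃ ν : Fin (m - n) → TangentSpace (𝓡 m) (f p), IsNormalFrame f p ν ∧
      ∀ α : Fin (m - n), (α : ℕ) ≠ 0 → ⟪g, ν α⟫ = 0 := by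
  obtain ⟨ν, hν, hνn, hν0⟩ :=
    exists_orthonormal_frame_aligned (F := TangentSpace (𝓡 m) (f p)) (normalSpace n f p)
      (hf.finrank_normalSpace p) hg
  exact ⟨ν, ⟨hν, fun α ↦ mem_normalSpace.1 (hνn α)⟩, hν0⟩

/-- In a space form, the ambient curvature operator of two tangent vectors maps normal vectors to
vectors without normal part. -/
theorem normalPart_curvature_eq_zero {c : ℝ} (hc : HasConstantSectionalCurvature m M' c) (p : M)
    (X Y : TangentSpace (𝓡 n) p) {N : TangentSpace (𝓡 m) (f p)} (hN : N ∈ normalSpace n f p) :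
    LocalGeometry.normalPart (chartMetric (f p)) (chartMap f p) (extChartAt (𝓡 n) p p)
      (LocalGeometry.curvature (chartMetric (f p))
        (chartMap (n := n) f p (extChartAt (𝓡 n) p p))
        (chartVector (f p) (mfderiv (𝓡 n) (𝓡 m) f p X))
        (chartVector (f p) (mfderiv (𝓡 n) (𝓡 m) f p Y)) (chartVector (f p) N)) = 0 := by
  have h := hf.isIsometricOn p
  have hy := mem_chartMapDomain (n := n) (m := m) f p
  set w := LocalGeometry.curvature (chartMetric (f p))
        (chartMap (n := n) f p (extChartAt (𝓡 n) p p))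
        (chartVector (f p) (mfderiv (𝓡 n) (𝓡 m) f p X))
        (chartVector (f p) (mfderiv (𝓡 n) (𝓡 m) f p Y)) (chartVector (f p) N) with hw
  -- ν is the normal part of w. It pairs to zero with w, since the constant curvature formula
  -- contains only products of tangent with normal vectors, and to zero with the tangential part of
  -- w; hence ⟨ν, ν⟩ = 0.
  obtain ⟨ν, hν⟩ := chartVector_surjective (q := f p) (LocalGeometry.normalPart
    (chartMetric (f p)) (chartMap f p) (extChartAt (𝓡 n) p p) w)
  have hνn : ν ∈ normalSpace n f p := by
    rw [mem_normalSpace]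
    intro Z
    rw [← hf.inner_chartVector p, hν, ← hf.fderiv_chartMap_chartVector, h.metric_normalPart hy]
  have h1 : chartMetric (f p) (chartMap (n := n) f p (extChartAt (𝓡 n) p p)) w
      (chartVector (f p) ν) = 0 := by
    have e : riemannTensor (f p) (mfderiv (𝓡 n) (𝓡 m) f p X) (mfderiv (𝓡 n) (𝓡 m) f p Y) N ν =
        chartMetric (f p) (chartMap (n := n) f p (extChartAt (𝓡 n) p p)) w
          (chartVector (f p) ν) := by
      rw [hw, chartMap_self]
      rfl
    rw [← e, riemannTensor_eq_of_constant hc, real_inner_comm N, real_inner_comm N,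
      mem_normalSpace.1 hN, mem_normalSpace.1 hN]
    ring
  have h2 : ⟪ν, ν⟫ = 0 := by
    rw [← hf.inner_chartVector p]
    nth_rewrite 1 [hν]
    rw [h.normalPart_eq hy, map_sub, _root_.sub_apply, h1,
      h.cod.symm _ (h.mapsTo hy), hν, h.metric_normalPart hy, sub_zero]
  rw [← hν, inner_self_eq_zero.1 h2]
  exact map_zero _

/-- The normal connection is trivial if the second fundamental form can be diagonalized at every
point. -/
theorem hasTrivialNormalConnection {c : ℝ} (hc : HasConstantSectionalCurvature m M' c)
    (hdiag : ∀ p : M, ∃ b : OrthonormalBasis (Fin n) ℝ (TangentSpace (𝓡 n) p),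
      ∀ i j, i ≠ j → hf.sff p (b i) (b j) = 0) :
    HasTrivialNormalConnection n m f := by
  intro p N hN hnormal X Y
  obtain ⟨b, hb⟩ := hdiag p
  have hy := mem_chartMapDomain (n := n) (m := m) f p
  have hev : ∀ᶠ y in 𝓝 (extChartAt (𝓡 n) p p), y ∈ chartMapDomain n m f p ∧
      ContDiffAt ℝ 2 N y ∧ ∀ u,
      chartMetric (f p) (chartMap f p y) (N y) (fderiv ℝ (chartMap f p) y u) = 0 :=
    ((hf.isOpen_chartMapDomain p).eventually_mem hy).and
      (((hN.of_le LocalGeometry.two_le_infty).eventually (by simp)).and hnormal)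
  obtain ⟨s, hs, hso, hys⟩ := eventually_nhds_iff.1 hev
  have h := (hf.isIsometricOn p).mono hso fun y hy ↦ (hs y hy).1
  obtain ⟨t, ht, hR⟩ := h.ricci_equation hys (fun z hz ↦ (hs z hz).2.1)
    (fun z hz ↦ (hs z hz).2.2) (chartVector p X) (chartVector p Y)
  obtain ⟨ν, hν⟩ := chartVector_surjective (q := f p) (N (extChartAt (𝓡 n) p p))
  have hνn : ν ∈ normalSpace n f p := by
    rw [mem_normalSpace]
    intro Z
    rw [← hf.inner_chartVector p, hν, ← hf.fderiv_chartMap_chartVector]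
    exact (hs _ hys).2.2 _
  -- In a basis diagonalizing σ, the vector `σ(A, t B)` is symmetric in A and B. The two such terms
  -- of the Ricci equation therefore cancel: the shape operators commute.
  have hshape (A B : TangentSpace (𝓡 n) p) :
      LocalGeometry.secondFundamentalForm (chartMetric (f p)) (chartMap f p)
        (extChartAt (𝓡 n) p p) (chartVector p A) (t (chartVector p B)) =
      chartVector (f p) (∑ i, (⟪b i, A⟫ * -(⟪b i, B⟫ * ⟪hf.sff p (b i) (b i), ν⟫)) •
        hf.sff p (b i) (b i)) := by
    obtain ⟨T, hT⟩ := chartVector_surjective (q := p) (t (chartVector p B))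
    rw [← hT, ← hf.chartVector_secondFundamentalForm, ← hf.sff_apply,
      bilin_apply_of_diagonal (hf.sff p) b hb A T]
    congr 1
    refine Finset.sum_congr rfl fun i _ ↦ ?_
    have h1 := ht (chartVector p B) (chartVector p (b i))
    rw [← hT, chartMetric_chartVector, ← hν, ← hf.chartVector_secondFundamentalForm,
      hf.inner_chartVector, ← hf.sff_apply, bilin_apply_of_diagonal (hf.sff p) b hb B (b i),
      Finset.sum_eq_single i (fun j _ hj ↦ by rw [b.orthonormal.2 hj, mul_zero, zero_smul])
      (by simp), real_inner_self_eq_norm_sq, b.norm_eq_one, inner_smul_right,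
      real_inner_comm (b i) T, real_inner_comm _ ν] at h1
    rw [h1]
    simp
  rw [hR, hshape, hshape, hf.fderiv_chartMap_chartVector, hf.fderiv_chartMap_chartVector, ← hν,
    hf.normalPart_curvature_eq_zero hc p X Y hνn, zero_sub, neg_add_eq_zero]
  congr 1
  refine Finset.sum_congr rfl fun i _ ↦ ?_
  congr 1
  ring

end NormalConnection

/-! ### The Casorati inequality and its equality case on the submanifold -/

section Casorati

variable {k m : ℕ}
  {M : Type*} [TopologicalSpace M] [ChartedSpace (EuclideanSpace ℝ (Fin (k + 1))) M]
  [IsManifold (𝓡 (k + 1)) ∞ M]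
  [Bundle.RiemannianBundle (fun x : M ↦ TangentSpace (𝓡 (k + 1)) x)]
  [IsContMDiffRiemannianBundle (𝓡 (k + 1)) ∞ (EuclideanSpace ℝ (Fin (k + 1)))
      (fun x : M ↦ TangentSpace (𝓡 (k + 1)) x)]
  {M' : Type*} [TopologicalSpace M'] [ChartedSpace (EuclideanSpace ℝ (Fin m)) M']
  [IsManifold (𝓡 m) ∞ M']
  [Bundle.RiemannianBundle (fun x : M' ↦ TangentSpace (𝓡 m) x)]
  [IsContMDiffRiemannianBundle (𝓡 m) ∞ (EuclideanSpace ℝ (Fin m))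
      (fun x : M' ↦ TangentSpace (𝓡 m) x)]
  {f : M → M'} (hf : IsRiemannianSubmanifold (k + 1) m f)
include hf

/-- Translates the geometric quantities into `casorati_inequality`; with n = k + 1, hyperplanes are
the subspaces of dimension k. -/
theorem normalizedScalarCurvature_le {c : ℝ} (hk : 0 < k)
    (hc : HasConstantSectionalCurvature m M' c) (p : M) :
    normalizedScalarCurvature (k + 1) p ≤ deltaHatCasorati (k + 1) m f p + c ∧
    (normalizedScalarCurvature (k + 1) p = deltaHatCasorati (k + 1) m f p + c ↔
      ∃ b : OrthonormalBasis (Fin (k + 1)) ℝ (TangentSpace (𝓡 (k + 1)) p),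
        IsHalfUmbilicalBasis (hf.sff p) b) := by
  have hV : Module.finrank ℝ (TangentSpace (𝓡 (k + 1)) p) = k + 1 := finrank_euclideanSpace_fin
  set e := stdOrthonormalBasis ℝ (TangentSpace (𝓡 (k + 1)) p)
  have hτ := hf.two_mul_scalarCurvature hc p
  have hcas (P : Submodule ℝ (TangentSpace (𝓡 (k + 1)) p)) : casoratiSubspace m f p P =
      1 / (Module.finrank ℝ P : ℝ) * restrictNormSq (hf.sff p) P := rfl
  have hD : deltaHatCasorati (k + 1) m f p =
      2 * (1 / (k + 1) * sumNormSq (hf.sff p) e) - (2 * (k + 1) - 1) / (2 * (k + 1)) *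
        sSup {x : ℝ | ∃ P : Submodule ℝ (TangentSpace (𝓡 (k + 1)) p), Module.finrank ℝ P = k ∧
          x = 1 / k * restrictNormSq (hf.sff p) P} := by
    have hset : {x : ℝ | ∃ P : Submodule ℝ (TangentSpace (𝓡 (k + 1)) p),
        Module.finrank ℝ P + 1 = k + 1 ∧ x = casoratiSubspace m f p P} =
        {x : ℝ | ∃ P : Submodule ℝ (TangentSpace (𝓡 (k + 1)) p), Module.finrank ℝ P = k ∧
          x = 1 / k * restrictNormSq (hf.sff p) P} := by
      ext x
      refine exists_congr fun P ↦ ?_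
      rw [add_left_inj]
      refine and_congr_right fun hP ↦ ?_
      rw [hcas, hP]
    have htop : (Module.finrank ℝ (⊤ : Submodule ℝ (TangentSpace (𝓡 (k + 1)) p)) : ℝ) = k + 1 := by
      rw [finrank_top, hV]
      push_cast
      rfl
    rw [deltaHatCasorati, casorati, hset, hcas, htop, restrictNormSq_top (hf.sff p) e]
    push_cast
    rfl
  have hnor : normalizedScalarCurvature (k + 1) p =
      2 * scalarCurvature (k + 1) p / (((k : ℝ) + 1) * k) := by
    rw [normalizedScalarCurvature]
    push_cast
    rw [add_sub_cancel_right]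
  rw [hnor]
  refine casorati_inequality (hf.sff_symm p) hk hV e ?_ hD
  rw [hτ]
  push_cast
  ring

/-- Any normal frame serves, because σ itself, not just one component, is diagonal in b. The last
basis vector is the common direction, and the other eigenvalue is twice its own. -/
theorem isInvariantlyQuasiUmbilicalAt_of_basis {p : M}
    {b : OrthonormalBasis (Fin (k + 1)) ℝ (TangentSpace (𝓡 (k + 1)) p)}
    (hb : IsHalfUmbilicalBasis (hf.sff p) b) {ν : Fin (m - (k + 1)) → TangentSpace (𝓡 m) (f p)}
    (hν : IsNormalFrame f p ν) : IsInvariantlyQuasiUmbilicalAt (k + 1) m f p := by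
  have hdiag (X : TangentSpace (𝓡 (k + 1)) p) (i : Fin (k + 1)) :
      hf.sff p X (b i) = ⟪b i, X⟫ • hf.sff p (b i) (b i) := by
    rw [bilin_apply_of_diagonal (hf.sff p) b hb.1 X (b i), Finset.sum_eq_single i
      (fun j _ hj ↦ by rw [b.orthonormal.2 hj, mul_zero, zero_smul]) (by simp),
      real_inner_self_eq_norm_sq, b.norm_eq_one]
    simp
  set g := hf.sff p (b (Fin.last k)) (b (Fin.last k)) with hg
  refine ⟨ν, b (Fin.last k), hν, b.norm_eq_one _, fun α ↦ ⟨2 * ⟪g, ν α⟫, ⟪g, ν α⟫, ?_, ?_⟩⟩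
  · refine InnerProductSpace.ext_inner_left_basis b.toBasis fun i ↦ ?_
    rw [b.coe_toBasis, hf.inner_shapeOperator, hdiag, inner_smul_left, inner_smul_right]
    rcases eq_or_ne i (Fin.last k) with rfl | hi
    · simp [hg, mul_comm]
    · simp [b.orthonormal.2 hi]
  · intro X hX
    refine InnerProductSpace.ext_inner_left_basis b.toBasis fun i ↦ ?_
    rw [b.coe_toBasis, hf.inner_shapeOperator, hdiag, inner_smul_left, inner_smul_right]
    induction i using Fin.lastCases with
    | last => simp [real_inner_comm X, hX]
    | cast i =>
      rw [hb.2 i, inner_smul_left]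
      simp
      ring

/-- All values of σ are multiples of the single vector g, so in a normal frame whose first vector is
aligned with g the later shape operators vanish. -/
theorem exists_shapeMatrix_of_basis {p : M}
    {b : OrthonormalBasis (Fin (k + 1)) ℝ (TangentSpace (𝓡 (k + 1)) p)}
    (hb : IsHalfUmbilicalBasis (hf.sff p) b) :
    ∃ (ν : Fin (m - (k + 1)) → TangentSpace (𝓡 m) (f p)) (a : ℝ), IsNormalFrame f p ν ∧
      ∀ α : Fin (m - (k + 1)), shapeMatrix f p b (ν α) =
        if (α : ℕ) = 0 then
          Matrix.diagonal (fun i : Fin (k + 1) ↦ if (i : ℕ) + 1 = k + 1 then a / 2 else a)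
        else 0 := by
  set g := hf.sff p (b (Fin.last k)) (b (Fin.last k)) with hg
  obtain ⟨ν, hν, hν0⟩ := hf.exists_isNormalFrame_aligned p
    (hf.sff_mem_normalSpace p (b (Fin.last k)) (b (Fin.last k)))
  -- The last diagonal entry a/2 must be the first normal component of g. In codimension zero no
  -- condition remains, and 0 is an arbitrary choice.
  refine ⟨ν, if h : 0 < m - (k + 1) then 2 * ⟪g, ν ⟨0, h⟩⟫ else 0, hν, fun α ↦ ?_⟩
  have hpos : 0 < m - (k + 1) := α.pos
  rw [dif_pos hpos]
  ext i j
  rw [hf.shapeMatrix_apply]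
  rcases eq_or_ne i j with rfl | hij
  · have hval : ⟪hf.sff p (b i) (b i), ν α⟫ =
        if (i : ℕ) + 1 = k + 1 then ⟪g, ν α⟫ else 2 * ⟪g, ν α⟫ := by
      induction i using Fin.lastCases with
      | last => simp [hg]
      | cast i =>
        rw [hb.2 i, inner_smul_left, if_neg (by simp [i.isLt.ne])]
        simp [hg]
    rw [hval]
    by_cases hα : (α : ℕ) = 0
    · have : α = ⟨0, hpos⟩ := Fin.ext hα
      rw [if_pos hα, Matrix.diagonal_apply_eq, this]
      split_ifs <;> ring
    · rw [if_neg hα, hν0 α hα]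
      simp
  · rw [hb.1 j i hij.symm, inner_zero_left]
    split_ifs
    · rw [Matrix.diagonal_apply_ne _ hij]
    · rfl

/-- The frame has as many vectors as the normal space has dimensions, so an identity between normal
vectors can be tested against it; those pairings are the given matrix entries. -/
theorem exists_basis_of_shapeMatrix {p : M} {e : Fin (k + 1) → TangentSpace (𝓡 (k + 1)) p}
    {ν : Fin (m - (k + 1)) → TangentSpace (𝓡 m) (f p)} {a : ℝ} (he : Orthonormal ℝ e)
    (hν : IsNormalFrame f p ν)
    (hA : ∀ α : Fin (m - (k + 1)), shapeMatrix f p e (ν α) =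
        if (α : ℕ) = 0 then
          Matrix.diagonal (fun i : Fin (k + 1) ↦ if (i : ℕ) + 1 = k + 1 then a / 2 else a)
        else 0) :
    ∃ b : OrthonormalBasis (Fin (k + 1)) ℝ (TangentSpace (𝓡 (k + 1)) p),
      IsHalfUmbilicalBasis (hf.sff p) b := by
  have hV : Module.finrank ℝ (TangentSpace (𝓡 (k + 1)) p) = k + 1 := finrank_euclideanSpace_fin
  have hspan := he.linearIndependent.span_eq_top_of_card_eq_finrank' (by simp [hV])
  have hzero {w : TangentSpace (𝓡 m) (f p)} (hw : w ∈ normalSpace (k + 1) f p)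
      (h0 : ∀ α, ⟪w, ν α⟫ = 0) : w = 0 :=
    eq_zero_of_inner_orthonormal_eq_zero _ (hf.finrank_normalSpace p) hν.1
      (fun α ↦ mem_normalSpace.2 (hν.2 α)) hw h0
  have hent (α) (i j : Fin (k + 1)) : ⟪hf.sff p (e i) (e j), ν α⟫ =
      (if (α : ℕ) = 0 then
          Matrix.diagonal (fun i : Fin (k + 1) ↦ if (i : ℕ) + 1 = k + 1 then a / 2 else a)
        else 0 : Matrix (Fin (k + 1)) (Fin (k + 1)) ℝ) j i := by
    rw [← hA, hf.shapeMatrix_apply]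
  refine ⟨OrthonormalBasis.mk he hspan.ge, ?_, ?_⟩
  · intro i j hij
    rw [OrthonormalBasis.coe_mk]
    refine hzero (hf.sff_mem_normalSpace p _ _) fun α ↦ ?_
    rw [hent]
    split_ifs
    · rw [Matrix.diagonal_apply_ne _ hij.symm]
    · rfl
  · intro i
    rw [OrthonormalBasis.coe_mk, ← sub_eq_zero]
    refine hzero (Submodule.sub_mem _ (hf.sff_mem_normalSpace p _ _)
      (Submodule.smul_mem _ _ (hf.sff_mem_normalSpace p _ _))) fun α ↦ ?_
    rw [inner_sub_left, inner_smul_left, hent, hent]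
    split_ifs
    · rw [Matrix.diagonal_apply_eq, Matrix.diagonal_apply_eq, if_neg (by simp [i.isLt.ne]),
        if_pos (by simp)]
      simp
      ring
    · simp

end Casorati

end IsRiemannianSubmanifold

end

theorem mainTheorem9 {n m : ℕ} (hn : 2 ≤ n) (c : ℝ)
    {M : Type*} [TopologicalSpace M] [ChartedSpace (EuclideanSpace ℝ (Fin n)) M]
    [IsManifold (𝓡 n) ∞ M]
    [Bundle.RiemannianBundle (fun x : M ↦ TangentSpace (𝓡 n) x)]
    [IsContMDiffRiemannianBundle (𝓡 n) ∞ (EuclideanSpace ℝ (Fin n))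
      (fun x : M ↦ TangentSpace (𝓡 n) x)]
    {M' : Type*} [TopologicalSpace M'] [ChartedSpace (EuclideanSpace ℝ (Fin m)) M']
    [IsManifold (𝓡 m) ∞ M']
    [Bundle.RiemannianBundle (fun x : M' ↦ TangentSpace (𝓡 m) x)]
    [IsContMDiffRiemannianBundle (𝓡 m) ∞ (EuclideanSpace ℝ (Fin m))
      (fun x : M' ↦ TangentSpace (𝓡 m) x)]
    (hc : HasConstantSectionalCurvature m M' c)
    (f : M → M') (hf : IsRiemannianSubmanifold n m f) :
    (∀ p : M, normalizedScalarCurvature n p ≤ deltaHatCasorati n m f p + c) ∧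
    ((∀ p : M, normalizedScalarCurvature n p = deltaHatCasorati n m f p + c) ↔
      ((∀ p : M, IsInvariantlyQuasiUmbilicalAt n m f p) ∧
        HasTrivialNormalConnection n m f ∧
        ∀ p : M, ∃ (e : Fin n → TangentSpace (𝓡 n) p)
          (ν : Fin (m - n) → TangentSpace (𝓡 m) (f p)) (a : ℝ),
          Orthonormal ℝ e ∧ IsNormalFrame f p ν ∧
          ∀ α : Fin (m - n), shapeMatrix f p e (ν α) =
            if (α : ℕ) = 0 then
              Matrix.diagonal (fun i : Fin n ↦ if (i : ℕ) + 1 = n then a / 2 else a)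
            else 0)) := by
  obtain ⟨k, rfl⟩ : ∃ k, n = k + 1 := ⟨n - 1, by omega⟩
  have hpt := hf.normalizedScalarCurvature_le (by omega) hc
  refine ⟨fun p ↦ (hpt p).1, fun heq ↦ ?_, fun h p ↦ ?_⟩
  · have hb (p : M) := (hpt p).2.1 (heq p)
    choose b hb using hb
    choose ν a hν hA using fun p ↦ hf.exists_shapeMatrix_of_basis (hb p)
    exact ⟨fun p ↦ hf.isInvariantlyQuasiUmbilicalAt_of_basis (hb p) (hν p),
      hf.hasTrivialNormalConnection hc fun p ↦ ⟨b p, (hb p).1⟩,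
      fun p ↦ ⟨b p, ν p, a p, (b p).orthonormal, hν p, hA p⟩⟩
  · obtain ⟨e, ν, a, he, hν, hA⟩ := h.2.2 p
    exact (hpt p).2.2 (hf.exists_basis_of_shapeMatrix he hν hA)
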